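/- Fix integers $N,d\ge 1$, an energy $E^*>0$, and set $I^*=[0,E^*]$. All spaces $(\mathbb R^d)^n$ carry the max-norm $|\cdot|$. Consider on $L^2((\mathbb R^d)^N)$ the random Schrödinger operator $$\mathbf H(\omega)=-\tfrac12\boldsymbol\Delta+\mathbf U(\mathbf x)+\sum_{j=1}^N V(x_j;\omega),\qquad V(x;\omega)=\sum_{a\in\mathbb Z^d}\mathcal V_a(\omega)\,\varphi_a(x-a),$$ under the following assumptions. (U) $\mathbf U(\mathbf x)=\sum_{1\le i<j\le N}U^{(2)}(|x_i-x_j|)$ with a measurable $U^{(2)}$ such that $0\le U^{(2)}(r)\le C_U e^{-r^\zeta}$ for all $r\ge 0$, for some $\zeta>0$, $C_U\in(0,\infty)$. (V) The scatterers $\varphi_a:\mathbb R^d\to[0,\infty)$ (identical ones, $\varphi_a=\varphi$, being the basic case) are measurable, their supports lie in a common set of diameter at most $r_1<\infty$, and they satisfy the flat tiling condition $\sum_{a\in\mathbb Z^d}\varphi_a(x-a)=C_\varphi$ for almost every $x\in\mathbb R^d$, where $C_\varphi\in(0,\infty)$ is a constant. The amplitudes $\mathcal V_a$, $a\in\mathbb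 Z^d$, are independent real random variables on a probability space, with a common probability density $p_V$ vanishing outside $[0,c_V]$, $c_V>0$, differentiable on $(0,c_V)$ and such that there $0<p_*\le p_V(t)\le p^*<\infty$ and $p_V'(t)\le C^*<\infty$, for some constants $p_*,p^*,C^*$. For $\mathbf x\in(\mathbb Z^d)^N$ and an integer $L\ge1$ let $\boldsymbol\Lambda_L(\mathbf x)=\{\mathbf z\in(\mathbb R^d)^N:|\mathbf z-\mathbf x|<L+\tfrac12\}$, and let $\Sigma^{I^*}_{\mathbf x,L}(\omega)$ be the part in $I^*$ of the spectrum of $\mathbf H(\omega)$ restricted to $\boldsymbol\Lambda_L(\mathbf x)$ with Dirichlet boundary conditions. Let $\mathrm d_S(\mathbf x,\mathbf y)=\min_{\pi}|\pi(\mathbf x)-\mathbf y|$, the minimum over all permutations $\pi$ of the $N$ particle positions. Then there exist constants $C_2,A_2\in(0,\infty)$, depending only on $N$, $d$, $E^*$, $C_\varphi$ and $p_V$, such that for all integers $L\ge 1$ with $2L\ge 1+r_1$, all $\mathbf x,\mathbf y\in(\mathbb Z^d)^N$ with $\mathrm d_S(\mathbf x,\mathbf y)>4NL$, and all $s\in(0,1]$,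 $$\mathbb P\Big\{\mathrm{dist}\big[\Sigma^{I^*}_{\mathbf x,L},\Sigma^{I^*}_{\mathbf y,L}\big]\le s\Big\}\le C_2\,L^{A_2}\,s^{2/3},$$ where $\mathrm{dist}[A,B]=\inf\{|a-b|:a\in A,\ b\in B\}$, equal to $+\infty$ if $A$ or $B$ is empty. -/

import Mathlib

open MeasureTheory ProbabilityTheory Filter Topology
open scoped ENNReal

namespace MultiParticle

/-- The `N`-particle configuration space `(ℝ^d)^N`. Its norm is the max-norm and `volume` on it is
Lebesgue measure. -/
abbrev Config (N d : ℕ) : Type := Fin N → Fin d → ℝ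

/-- The lattice `(ℤ^d)^N`, with the max-norm distance. -/
abbrev LatticeConfig (N d : ℕ) : Type := Fin N → Fin d → ℤ

/-- The open cube of edge length `2 L + 1` centred at the lattice point `u`. -/
def cube {N d : ℕ} (u : LatticeConfig N d) (L : ℕ) : Set (Config N d) :=
  Metric.ball (fun j k => (u j k : ℝ)) ((L : ℝ) + 1 / 2)

/-- The symmetrized norm-distance `min_π ‖π(x) - y‖_∞`, where `π` permutes the particles. -/
noncomputable def symDist {N d : ℕ} (x y : LatticeConfig N d) : ℝ :=
  Finset.univ.inf' (Finset.univ_nonempty (α := Equiv.Perm (Fin N)))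
    (fun π => dist (fun j => x (π j)) y)

section Potentials

/-- A two-body potential on `[0, ∞)` with `0 ≤ U(r) ≤ C e^{-r^ζ}`. -/
structure IsTwoBodyPotential (U : ℝ → ℝ) : Prop where
  measurable : Measurable U
  decay : ∃ ζ C : ℝ, 0 < ζ ∧ 0 < C ∧ ∀ r : ℝ, 0 ≤ r → 0 ≤ U r ∧ U r ≤ C * Real.exp (-(r ^ ζ))

/-- The interaction energy `∑_{i < j} U(|x_i - x_j|)`. -/
noncomputable def interaction {N d : ℕ} (U : ℝ → ℝ) (z : Config N d) : ℝ :=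
  ∑ i, ∑ j, if i < j then U (dist (z i) (z j)) else 0

/-- A flat tiling family of scatterers, `φ a` being translated to the lattice point `a`: the
supports of all the functions `φ a` lie in a common set of diameter at most `r₁`, and
`∑_a φ_a(x - a) = Cφ` for almost every `x`. Identical scatterers are the case of a constant
family. -/
structure IsFlatTiling {d : ℕ} (φ : (Fin d → ℤ) → (Fin d → ℝ) → ℝ) (r₁ Cφ : ℝ) : Prop where
  measurable : ∀ a, Measurable (φ a)
  nonneg : ∀ a q, 0 ≤ φ a q
  diam_support : ∀ a b q q', φ a q ≠ 0 → φ b q' ≠ 0 → dist q q' ≤ r₁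
  tiling : ∀ᵐ q : Fin d → ℝ, ∑' a : Fin d → ℤ, φ a (fun k => q k - (a k : ℝ)) = Cφ

/-- The one-particle alloy potential `∑_a v_a φ_a(q - a)` with amplitudes `v`. -/
noncomputable def alloyPotential {d : ℕ} (φ : (Fin d → ℤ) → (Fin d → ℝ) → ℝ)
    (v : (Fin d → ℤ) → ℝ) (q : Fin d → ℝ) : ℝ :=
  ∑' a : Fin d → ℤ, v a * φ a (fun k => q k - (a k : ℝ))

/-- The total potential energy: interaction plus external field acting on each particle. -/
noncomputable def potential {N d : ℕ} (U : ℝ → ℝ) (φ : (Fin d → ℤ) → (Fin d → ℝ) → ℝ)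
    (v : (Fin d → ℤ) → ℝ) (z : Config N d) : ℝ :=
  interaction U z + ∑ j, alloyPotential φ v (z j)

/-- The conditions on the density `p` of a scatterer amplitude: it is supported by `[0, c]`, and on
`(0, c)` it is differentiable, bounded between two positive constants, with derivative bounded from
above. -/
structure IsAmplitudeDensity (p : ℝ → ℝ) (c : ℝ) : Prop where
  pos : 0 < c
  support : ∀ t, t ∉ Set.Icc 0 c → p t = 0
  bounds : ∃ pmin pmax : ℝ, 0 < pmin ∧ ∀ t ∈ Set.Ioo 0 c, pmin ≤ p t ∧ p t ≤ pmax
  deriv_bound : ∃ C : ℝ, ∀ t ∈ Set.Ioo 0 c, DifferentiableAt ℝ p t ∧ deriv p t ≤ C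

/-- The amplitudes `𝒱 a`, `a ∈ ℤ^d`, are independent random variables with common density `p`. -/
structure IsIIDField {d : ℕ} {Ω : Type*} [MeasurableSpace Ω] (P : Measure Ω)
    (𝒱 : (Fin d → ℤ) → Ω → ℝ) (p : ℝ → ℝ) : Prop where
  measurable : ∀ a, Measurable (𝒱 a)
  indep : iIndepFun 𝒱 P
  law : ∀ a, P.map (𝒱 a) = volume.withDensity (fun t => ENNReal.ofReal (p t))

end Potentials

section Hamiltonian

variable {N d : ℕ}

/-- The complex Hilbert space `L²(Λ)`. -/
abbrev L2 (Λ : Set (Config N d)) : Type := Lp ℂ 2 (volume.restrict Λ)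

/-- The space `C_c^∞(Λ)` of test functions. -/
def IsTestFunction (Λ : Set (Config N d)) (g : Config N d → ℂ) : Prop :=
  ContDiff ℝ ((⊤ : ℕ∞) : WithTop ℕ∞) g ∧ HasCompactSupport g ∧ tsupport g ⊆ Λ

/-- The partial derivative with respect to the `k`-th coordinate of the `j`-th particle. -/
noncomputable def partialDeriv (g : Config N d → ℂ) (j : Fin N) (k : Fin d) (z : Config N d) : ℂ :=
  fderiv ℝ g z (Pi.single j (Pi.single k 1))

/-- `u` lies in the Sobolev space `H¹₀(Λ)`, the closure of `C_c^∞(Λ)` in the `H¹` norm, and `G` is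
its gradient. -/
def HasH10Gradient (Λ : Set (Config N d)) (u : L2 Λ) (G : Fin N → Fin d → L2 Λ) : Prop :=
  ∃ g : ℕ → Config N d → ℂ, (∀ n, IsTestFunction Λ (g n)) ∧
    Tendsto (fun n => eLpNorm (fun z => g n z - u z) 2 (volume.restrict Λ)) atTop (𝓝 0) ∧
    ∀ j k, Tendsto (fun n => eLpNorm (fun z => partialDeriv (g n) j k z - G j k z) 2
      (volume.restrict Λ)) atTop (𝓝 0)

/-- `u` lies in the domain of the Dirichlet operator `H = -(1/2)Δ + W` on `Λ`, and `H u = f`: `u`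
lies in `H¹₀(Λ)` and `H u = f` holds weakly. -/
def IsHamiltonianValue (Λ : Set (Config N d)) (W : Config N d → ℝ) (u f : L2 Λ) : Prop :=
  ∃ G : Fin N → Fin d → L2 Λ, HasH10Gradient Λ u G ∧
    ∀ v : Config N d → ℂ, IsTestFunction Λ v →
      (1 / 2 : ℂ) * (∑ j, ∑ k, (∫ z in Λ, G j k z * starRingEnd ℂ (partialDeriv v j k z)))
        + (∫ z in Λ, (W z : ℂ) * u z * starRingEnd ℂ (v z))
      = (∫ z in Λ, f z * starRingEnd ℂ (v z))

/-- `H - E` has a bounded everywhere defined inverse on `L²(Λ)`. -/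
def InResolventSet (Λ : Set (Config N d)) (W : Config N d → ℝ) (E : ℝ) : Prop :=
  ∃ R : L2 Λ →L[ℂ] L2 Λ, ∀ u f : L2 Λ, R f = u ↔ IsHamiltonianValue Λ W u (f + (E : ℂ) • u)

/-- The spectrum in `[0, Emax]` of the Dirichlet operator `-(1/2)Δ + W` on `Λ`. -/
def spectrumUpTo (Λ : Set (Config N d)) (W : Config N d → ℝ) (Emax : ℝ) : Set ℝ :=
  {E | ¬ InResolventSet Λ W E} ∩ Set.Icc 0 Emax

end Hamiltonian

/-- The distance `inf {|a - b| : a ∈ A, b ∈ B}` of two sets of reals, infinite if one is empty. -/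
noncomputable def setDist (A B : Set ℝ) : ℝ≥0∞ := ⨅ a ∈ A, Metric.infEDist a B

end MultiParticle

open MultiParticle

open scoped InnerProductSpace

namespace MultiParticle

/-! ### Symmetric operators bounded below through an index condition -/

section BoundedBelow

variable {K H : Type*} [NormedAddCommGroup K] [InnerProductSpace ℂ K]
  [NormedAddCommGroup H] [InnerProductSpace ℂ H]

/-! The mechanism is a comparison of energy levels under a shift of amplitudes. Since the
symmetrized distance of the centres exceeds `4 L`, Hall's marriage theorem yields a set `J` of
particles of the first cube such that the scatterers `Q` acting on them reach fewer than `|J|`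
particles of the second (`IsFlatTiling.exists_separating`). By flat tiling, raising all amplitudes
on `Q` by `t` adds at least `|J| Cφ t` to the first potential and at most `(|J| - 1) Cφ t` to the
second. By min-max, the difference of a level of the first cube and one of the second grows at rate
at least `Cφ`. Hence the amplitudes for which two given levels are `s`-close meet each line in the
direction `1_Q` in a set of diameter `O(s)` (`IsFlatTiling.shiftOn_notMem_closeLevels`).

A set `S` of diameter at most `h` along these lines has probability `O(h^(2/3))`
(`IsAmplitudeDensity.exists_measure_le`). Its translates by multiples of `2 h` are disjoint. Moving
amplitudes down by at most `T` costs a bounded factor if they start above `T` and `T |Q|` is small,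
because `p'` is bounded above. So the part of `S` with all amplitudes on `Q` above `T` has
probability at most of order `h / T` times that of the region swept by its translates. A single
scale would give `T + h / T`, hence only `h^(1/2)`. Two scales `T₁ = h^(2/3)`, `T₂ = h^(1/3)` give
`T₁ + (h / T₁) T₂ + h / T₂`: the part with some amplitude below `T₂` sweeps a region of probability
only `O(T₂)`.

A union bound over pairs of levels concludes, given two spectral facts. Every spectral point in `[0,
Emax]` is a variational level (`exists_energyLevel_eq`), since off the levels the form operator on
`H¹₀` is invertible. The number of levels below `Emax + 1` is polynomial in `L`
(`exists_card_energyLevel_le`), by Bessel's inequality for averages over small boxes. -/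

theorem bijective_of_isSymmetric_of_bounded_below [CompleteSpace K] {A : K →L[ℂ] K}
    (hA : (A : K →ₗ[ℂ] K).IsSymmetric) {ε : ℝ} (hε : 0 < ε) (h : ∀ x, ε * ‖x‖ ≤ ‖A x‖) :
    Function.Bijective A := by
  have hanti : AntilipschitzWith (Real.toNNReal ε⁻¹) A := by
    refine A.antilipschitz_of_bound fun x => ?_
    rw [Real.coe_toNNReal _ (by positivity), inv_mul_eq_div, le_div_iff₀ hε, mul_comm]
    exact h x
  refine ⟨hanti.injective, ?_⟩
  have hcl : IsClosed (A.range : Set K) := by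
    exact hanti.isClosed_range A.uniformContinuous
  have : CompleteSpace A.range := hcl.completeSpace_coe
  -- The range is closed, so surjectivity reduces to its orthogonal complement, which by symmetry
  -- lies in the kernel of `A`.
  have hbot : (A.range)ᗮ = ⊥ := by
    rw [Submodule.eq_bot_iff]
    intro y hy
    have h0 : A y = 0 := by
      have h1 : ⟪A (A y), y⟫_ℂ = 0 :=
        (Submodule.mem_orthogonal _ _).1 hy _ ⟨A y, rfl⟩
      have h2 : ⟪A (A y), y⟫_ℂ = ⟪A y, A y⟫_ℂ := hA (A y) y
      rw [h2] at h1
      exact inner_self_eq_zero.1 h1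
    exact hanti.injective (by simpa using h0)
  have htop : A.range = ⊤ := (Submodule.orthogonal_eq_bot_iff).1 hbot
  exact LinearMap.range_eq_top.1 htop

/-- The compression of `A` to the finite-dimensional `F` is injective, hence surjective; so the
form, although indefinite on `K`, admits a projection onto `F`. -/
theorem exists_form_projection {A : K →L[ℂ] K}
    (F : Submodule ℂ K) [FiniteDimensional ℂ F]
    (hF : ∀ x ∈ F, ⟪x, A x⟫_ℂ = 0 → x = 0) (u : K) :
    ∃ f ∈ F, ∀ g ∈ F, ⟪g, A (u - f)⟫_ℂ = 0 := by
  let T : F →ₗ[ℂ] F := (F.orthogonalProjectionOnto ∘L A ∘L F.subtypeL).toLinearMap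
  have hT : ∀ (f g : F), ⟪(g : K), A f⟫_ℂ = ⟪g, T f⟫_ℂ := by
    intro f g
    have : T f = F.orthogonalProjectionOnto (A f) := rfl
    rw [this]
    exact (Submodule.inner_orthogonalProjectionOnto_eq_of_mem_left g (A f)).symm
  have hinj : Function.Injective T := by
    rw [injective_iff_map_eq_zero]
    intro f hf
    have := hT f f
    rw [hf, inner_zero_right] at this
    exact Subtype.ext (hF f f.2 this)
  obtain ⟨f, hf⟩ := LinearMap.injective_iff_surjective.1 hinj (F.orthogonalProjectionOnto (A u))
  refine ⟨f, f.2, fun g hg => ?_⟩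
  have h1 := hT f ⟨g, hg⟩
  rw [hf] at h1
  have h2 := Submodule.inner_orthogonalProjectionOnto_eq_of_mem_left (K := F) ⟨g, hg⟩ (A u)
  rw [map_sub, inner_sub_right, sub_eq_zero]
  exact h2.symm.trans h1.symm

variable {ι : K →L[ℂ] H} {A : K →L[ℂ] K}

theorem re_inner_add_smul_of_form_orthogonal (hA : (A : K →ₗ[ℂ] K).IsSymmetric) {f w : K}
    (h : ⟪f, A w⟫_ℂ = 0) (c : ℂ) :
    (⟪f + c • w, A (f + c • w)⟫_ℂ).re = (⟪f, A f⟫_ℂ).re + ‖c‖ ^ 2 * (⟪w, A w⟫_ℂ).re := by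
  have h' : ⟪w, A f⟫_ℂ = 0 := by
    have : ⟪A w, f⟫_ℂ = ⟪w, A f⟫_ℂ := hA w f
    rw [← this, ← inner_conj_symm, h, map_zero]
  simp only [map_add, map_smul, inner_add_left, inner_add_right, inner_smul_left, inner_smul_right,
    h, h', mul_zero, add_zero, zero_add, Complex.add_re]
  rw [← mul_assoc, Complex.mul_conj, Complex.re_ofReal_mul, Complex.normSq_eq_norm_sq]

/-- Cross terms vanish on `F ⊕ ℂ w`, so a smaller value at `w` would keep the form below `δ ‖ι x‖²`
on that whole space, which `hpos` forbids. The factor `1 / 4` absorbs `‖c • ι w‖² ≤ 2 ‖ι (f + c •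
w)‖² + 2 ‖ι f‖²`. -/
theorem form_ge_of_form_orthogonal (hA : (A : K →ₗ[ℂ] K).IsSymmetric)
    {D F : Submodule ℂ K} [FiniteDimensional ℂ F] (hFD : F ≤ D) {δ : ℝ} (hδ : 0 < δ)
    (hneg : ∀ x ∈ F, (⟪x, A x⟫_ℂ).re ≤ -δ * ‖ι x‖ ^ 2)
    (hpos : ∀ G ≤ D, Module.finrank ℂ G = Module.finrank ℂ F + 1 →
      ∃ x ∈ G, δ * ‖ι x‖ ^ 2 < (⟪x, A x⟫_ℂ).re)
    {w : K} (hw : w ∈ D) (horth : ∀ f ∈ F, ⟪f, A w⟫_ℂ = 0) :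
    δ / 4 * ‖ι w‖ ^ 2 ≤ (⟪w, A w⟫_ℂ).re := by
  by_contra! hlt
  have hwF : w ∉ F := by
    intro hwF
    have h1 := hneg w hwF
    have h2 : (⟪w, A w⟫_ℂ).re = 0 := by rw [horth w hwF]; rfl
    nlinarith [sq_nonneg ‖ι w‖]
  have hrank : Module.finrank ℂ (F ⊔ Submodule.span ℂ {w} : Submodule ℂ K)
      = Module.finrank ℂ F + 1 := by
    have h0 : w ≠ 0 := fun h => hwF (h ▸ F.zero_mem)
    have h1 := Submodule.finrank_sup_add_finrank_inf_eq F (Submodule.span ℂ {w})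
    have h2 : F ⊓ Submodule.span ℂ {w} = ⊥ := by
      rw [← disjoint_iff]
      exact (Submodule.disjoint_span_singleton' h0).2 hwF
    rw [h2, finrank_bot, finrank_span_singleton h0] at h1
    simpa using h1
  obtain ⟨x, hx, hxlt⟩ := hpos _ (sup_le hFD (by simpa using hw)) hrank
  obtain ⟨f, hf, y, hy, rfl⟩ := Submodule.mem_sup.1 hx
  obtain ⟨c, rfl⟩ := Submodule.mem_span_singleton.1 hy
  rw [re_inner_add_smul_of_form_orthogonal hA (horth f hf)] at hxlt
  have h1 := hneg f hf
  have h2 : ‖c‖ ^ 2 * (⟪w, A w⟫_ℂ).re ≤ ‖c‖ ^ 2 * (δ / 4 * ‖ι w‖ ^ 2) := by gcongr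
  have h3 : ‖c‖ * ‖ι w‖ ≤ ‖ι (f + c • w)‖ + ‖ι f‖ := by
    have : ι (c • w) = ι (f + c • w) - ι f := by simp
    rw [← norm_smul, ← map_smul, this]
    exact norm_sub_le _ _
  have h4 : (‖c‖ * ‖ι w‖) ^ 2 ≤ (‖ι (f + c • w)‖ + ‖ι f‖) ^ 2 := by gcongr
  nlinarith [sq_nonneg (‖ι (f + c • w)‖ - ‖ι f‖), sq_nonneg ‖ι (f + c • w)‖, sq_nonneg ‖ι f‖]

/-- The form is negative on `F` and positive on its form-complement, so testing `A u` against `w -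
f`, where `u = w + f`, makes both contributions positive. Gårding's inequality upgrades bounds in
`‖ι x‖` to bounds in `‖x‖`, and density passes from `D` to `K`. -/
theorem exists_bounded_below (hA : (A : K →ₗ[ℂ] K).IsSymmetric)
    {α M : ℝ} (hα : 0 < α) (hM : 0 < M)
    (hgarding : ∀ x, α * ‖x‖ ^ 2 ≤ (⟪x, A x⟫_ℂ).re + M * ‖ι x‖ ^ 2)
    {D F : Submodule ℂ K} (hD : Dense (D : Set K))
    [FiniteDimensional ℂ F] (hFD : F ≤ D) {δ : ℝ} (hδ : 0 < δ)
    (hneg : ∀ x ∈ F, (⟪x, A x⟫_ℂ).re ≤ -δ * ‖ι x‖ ^ 2)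
    (hpos : ∀ G ≤ D, Module.finrank ℂ G = Module.finrank ℂ F + 1 →
      ∃ x ∈ G, δ * ‖ι x‖ ^ 2 < (⟪x, A x⟫_ℂ).re) :
    ∃ ε > 0, ∀ x, ε * ‖x‖ ≤ ‖A x‖ := by
  -- Inserting `‖ι w‖² ≤ (4 / δ) ⟪w, A w⟫` into `hgarding` gives this constant; it also serves on
  -- `F`.
  set ε₀ : ℝ := α * δ / (δ + 4 * M) with hε₀
  have hε₀pos : 0 < ε₀ := by positivity
  have hε₀mul : ε₀ * (δ + 4 * M) = α * δ := by rw [hε₀]; field_simp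
  have hFneg : ∀ f ∈ F, (⟪f, A f⟫_ℂ).re ≤ -ε₀ * ‖f‖ ^ 2 := by
    intro f hf
    have h1 := hneg f hf
    have h2 := hgarding f
    have h3 : α * δ * ‖f‖ ^ 2 ≤ - (δ + 4 * M) * (⟪f, A f⟫_ℂ).re := by
      have h4 : (⟪f, A f⟫_ℂ).re ≤ 0 := by nlinarith [sq_nonneg ‖ι f‖]
      nlinarith [mul_le_mul_of_nonneg_left h1 hM.le, mul_le_mul_of_nonneg_left h2 hδ.le,
        mul_nonneg hδ.le (neg_nonneg.2 h4), mul_nonneg hM.le (neg_nonneg.2 h4)]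
    rw [← hε₀mul] at h3
    nlinarith [sq_nonneg ‖f‖]
  have hker : ∀ x ∈ F, ⟪x, A x⟫_ℂ = 0 → x = 0 := by
    intro x hx h0
    have h1 := hFneg x hx
    rw [h0, Complex.zero_re] at h1
    have : ‖x‖ ^ 2 ≤ 0 := by nlinarith
    simpa using this
  have key : ∀ x ∈ D, ε₀ / 2 * ‖x‖ ≤ ‖A x‖ := by
    intro u hu
    obtain ⟨f, hf, horth⟩ := exists_form_projection F hker u
    set w := u - f with hw
    have hwD : w ∈ D := D.sub_mem hu (hFD hf)
    have h1 := form_ge_of_form_orthogonal hA hFD hδ hneg hpos hwD horth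
    have h2 := hgarding w
    have h3 : ε₀ * ‖w‖ ^ 2 ≤ (⟪w, A w⟫_ℂ).re := by
      have h4 : α * δ * ‖w‖ ^ 2 ≤ (δ + 4 * M) * (⟪w, A w⟫_ℂ).re := by
        nlinarith [sq_nonneg ‖ι w‖]
      rw [← hε₀mul] at h4
      nlinarith [sq_nonneg ‖w‖]
    have h4 := hFneg f hf
    have huw : u = w + f := by simp [hw]
    have hfw : ⟪f, A w⟫_ℂ = 0 := horth f hf
    have hwf : ⟪w, A f⟫_ℂ = 0 := by
      have : ⟪A w, f⟫_ℂ = ⟪w, A f⟫_ℂ := hA w f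
      rw [← this, ← inner_conj_symm, hfw, map_zero]
    have h5 : (⟪w - f, A u⟫_ℂ).re = (⟪w, A w⟫_ℂ).re - (⟪f, A f⟫_ℂ).re := by
      rw [huw]
      simp [hfw, hwf, sub_eq_add_neg]
    have h6 : (⟪w - f, A u⟫_ℂ).re ≤ (‖w‖ + ‖f‖) * ‖A u‖ :=
      (Complex.re_le_norm _).trans ((norm_inner_le_norm _ _).trans
        (by gcongr; exact norm_sub_le _ _))
    have h7 : ‖u‖ ≤ ‖w‖ + ‖f‖ := by rw [huw]; exact norm_add_le _ _
    rcases (add_nonneg (norm_nonneg w) (norm_nonneg f)).eq_or_lt with h0 | h0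
    · have : ‖u‖ = 0 := le_antisymm (h7.trans h0.symm.le) (norm_nonneg _)
      rw [this, mul_zero]; positivity
    · have h8 : ε₀ / 2 * (‖w‖ + ‖f‖) ≤ ‖A u‖ := by
        by_contra! hcon
        have := mul_lt_mul_of_pos_left hcon h0
        nlinarith [sq_nonneg (‖w‖ - ‖f‖)]
      exact (by gcongr : ε₀ / 2 * ‖u‖ ≤ ε₀ / 2 * (‖w‖ + ‖f‖)).trans h8
  refine ⟨ε₀ / 2, by positivity, fun x => ?_⟩
  have hclosed : IsClosed {x : K | ε₀ / 2 * ‖x‖ ≤ ‖A x‖} :=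
    isClosed_le (by fun_prop) (by fun_prop)
  exact hclosed.closure_subset_iff.2 key (hD x)

end BoundedBelow

/-! ### Variational levels of quadratic forms -/

section Level

variable {K H : Type*} [NormedAddCommGroup K] [InnerProductSpace ℂ K]
  [NormedAddCommGroup H] [InnerProductSpace ℂ H]

/-- The variational level of index `k` of the quadratic form `q` relative to `‖ι x‖²`, over trial
spaces contained in `D`, truncated to `[0, B]`. -/
noncomputable def level (D : Submodule ℂ K) (ι : K →L[ℂ] H) (q : K → ℝ) (B : ℝ) (k : ℕ) : ℝ :=
  sInf (insert B {μ : ℝ | 0 ≤ μ ∧ ∃ F ≤ D, Module.finrank ℂ F = k + 1 ∧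
    ∀ x ∈ F, q x ≤ μ * ‖ι x‖ ^ 2})

variable {D : Submodule ℂ K} {ι : K →L[ℂ] H} {q q' : K → ℝ} {B : ℝ} {k : ℕ}

theorem bddBelow_levelSet (hB : 0 ≤ B) (q : K → ℝ) :
    BddBelow (insert B {μ : ℝ | 0 ≤ μ ∧ ∃ F ≤ D, Module.finrank ℂ F = k + 1 ∧
    ∀ x ∈ F, q x ≤ μ * ‖ι x‖ ^ 2}) := by
  refine ⟨0, ?_⟩
  rintro μ (rfl | h)
  exacts [hB, h.1]

theorem level_le (hB : 0 ≤ B) : level D ι q B k ≤ B :=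
  csInf_le (bddBelow_levelSet hB q) (Set.mem_insert _ _)

theorem exists_of_level_lt {E : ℝ} (hE : level D ι q B k < E) (hEB : E ≤ B) :
    ∃ μ < E, 0 ≤ μ ∧ ∃ F ≤ D, Module.finrank ℂ F = k + 1 ∧ ∀ x ∈ F, q x ≤ μ * ‖ι x‖ ^ 2 := by
  obtain ⟨μ, hμ, hμE⟩ := exists_lt_of_csInf_lt ⟨B, Set.mem_insert _ _⟩ hE
  rcases hμ with rfl | hμ
  · exact absurd hμE hEB.not_gt
  · exact ⟨μ, hμE, hμ⟩

theorem exists_form_gt_of_lt_level (hB : 0 ≤ B) {E : ℝ} (hE0 : 0 ≤ E) (hE : E < level D ι q B k)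
    {F : Submodule ℂ K} (hF : F ≤ D) (hrank : Module.finrank ℂ F = k + 1) :
    ∃ x ∈ F, E * ‖ι x‖ ^ 2 < q x := by
  by_contra! h
  exact hE.not_ge (csInf_le (bddBelow_levelSet hB q) (Or.inr ⟨hE0, F, hF, hrank, h⟩))

theorem level_le_level_add (hB : 0 ≤ B) {t : ℝ} (ht : 0 ≤ t)
    (h : ∀ x, q x ≤ q' x + t * ‖ι x‖ ^ 2) : level D ι q B k ≤ level D ι q' B k + t := by
  rw [← sub_le_iff_le_add]
  refine le_csInf ⟨B, Set.mem_insert _ _⟩ ?_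
  rintro μ (rfl | ⟨h0, F, hF, hr, hμ⟩)
  · linarith [level_le (D := D) (ι := ι) (q := q) (k := k) hB]
  · rw [sub_le_iff_le_add]
    refine csInf_le (bddBelow_levelSet hB q) (Or.inr ⟨by positivity, F, hF, hr, fun x hx => ?_⟩)
    linarith [h x, hμ x hx]

/-- A trial bound `μ` for `q'` becomes `μ - t` for `q`, which must stay nonnegative to compete in
the infimum; if `μ < t`, positivity of `q` would make the trial space trivial. The condition `hlt`
excludes the truncation at `B`, where a level can no longer rise. -/
theorem level_add_le (hB : 0 ≤ B) {t : ℝ}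
    (h : ∀ x, q x + t * ‖ι x‖ ^ 2 ≤ q' x) (hq : ∀ x, 0 ≤ q x)
    (hι : ∀ x, q' x ≤ 0 → ι x = 0 → x = 0) (hlt : level D ι q' B k < B) :
    level D ι q B k + t ≤ level D ι q' B k := by
  refine le_of_forall_gt_imp_ge_of_dense fun E hE => ?_
  obtain ⟨μ, hμE, hμ0, F, hF, hr, hμ⟩ := exists_of_level_lt
    (lt_min hE hlt) (min_le_right _ _)
  have hμE : μ < E := hμE.trans_le (min_le_left _ _)
  have hμt : t ≤ μ := by
    by_contra! hcon
    have : F = ⊥ := by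
      rw [Submodule.eq_bot_iff]
      intro x hx
      have h1 := hμ x hx
      have h2 := h x
      have h3 := hq x
      have h4 : ‖ι x‖ ^ 2 ≤ 0 := by nlinarith [sq_nonneg ‖ι x‖]
      have h5 : ‖ι x‖ ^ 2 = 0 := le_antisymm h4 (sq_nonneg _)
      refine hι x (by rw [h5] at h1; linarith) (by simpa using h5)
    rw [this, finrank_bot] at hr
    omega
  have : level D ι q B k ≤ μ - t := by
    refine csInf_le (bddBelow_levelSet hB q) (Or.inr ⟨by linarith, F, hF, hr, fun x hx => ?_⟩)
    linarith [h x, hμ x hx]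
  linarith

/-- If `E` is not a level, then the operator of the form `q - E ‖ι ·‖²` is bounded below. -/
theorem exists_bounded_below_of_ne_level {A : K →L[ℂ] K} (hA : (A : K →ₗ[ℂ] K).IsSymmetric)
    {E α M : ℝ} (hα : 0 < α) (hM : 0 < M)
    (hgarding : ∀ x, α * ‖x‖ ^ 2 ≤ (⟪x, A x⟫_ℂ).re + M * ‖ι x‖ ^ 2)
    (hD : Dense (D : Set K)) (hE0 : 0 ≤ E)
    (hq : ∀ x, q x = (⟪x, A x⟫_ℂ).re + E * ‖ι x‖ ^ 2) (hEB : E < B) {n : ℕ}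
    (hn : E < level D ι q B n) (hne : ∀ k < n, level D ι q B k ≠ E) :
    ∃ ε > 0, ∀ x, ε * ‖x‖ ≤ ‖A x‖ := by
  classical
  have hB : 0 ≤ B := hE0.trans hEB.le
  have hex : ∃ m, E < level D ι q B m := ⟨n, hn⟩
  -- `m` is the index of the first level above `E`. The level just before it lies strictly below `E`
  -- and supplies `F`; for `m = 0` the trivial space does.
  obtain ⟨m, hm, hmin⟩ : ∃ m, E < level D ι q B m ∧ ∀ k < m, level D ι q B k < E :=
    ⟨Nat.find hex, Nat.find_spec hex, fun k hk =>
      lt_of_le_of_ne (not_lt.1 (Nat.find_min hex hk))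
        (hne k (hk.trans_le (Nat.find_min' hex hn)))⟩
  obtain ⟨F, hFD, hFr, hFf, μ, hμE, hμ⟩ : ∃ F ≤ D, Module.finrank ℂ F = m ∧
      FiniteDimensional ℂ F ∧ ∃ μ < E, ∀ x ∈ F, q x ≤ μ * ‖ι x‖ ^ 2 := by
    rcases m with _ | m
    · refine ⟨⊥, bot_le, finrank_bot ℂ K, inferInstance, E - 1, by linarith, ?_⟩
      intro x hx
      rw [Submodule.mem_bot] at hx
      simp [hq, hx]
    · obtain ⟨μ, hμE, -, F, hF, hr, hμ⟩ := exists_of_level_lt (hmin m (Nat.lt_succ_self m)) hEB.le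
      exact ⟨F, hF, hr, Module.finite_of_finrank_pos (by omega), μ, hμE, hμ⟩
  obtain ⟨E', hE', hE'l⟩ := exists_between hm
  set δ := min (E - μ) (E' - E) with hδ
  have hδpos : 0 < δ := lt_min (by linarith) (by linarith)
  refine exists_bounded_below hA hα hM hgarding hD hFD hδpos ?_ ?_
  · intro x hx
    have h1 := hμ x hx
    have h2 : δ ≤ E - μ := min_le_left _ _
    rw [hq] at h1
    nlinarith [sq_nonneg ‖ι x‖]
  · intro G hG hGr
    obtain ⟨x, hx, hlt⟩ := exists_form_gt_of_lt_level hB (by linarith) hE'l hG (by omega)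
    refine ⟨x, hx, ?_⟩
    have h2 : δ ≤ E' - E := min_le_right _ _
    rw [hq] at hlt
    nlinarith [sq_nonneg ‖ι x‖]

end Level

/-! ### Comparison of product measures -/

section ProductMeasures

variable {ι : Type*} [Fintype ι] {X : ι → Type*} [∀ i, MeasurableSpace (X i)]

theorem pi_le_pi {μ ν : ∀ i, Measure (X i)} (h : ∀ i, μ i ≤ ν i) :
    Measure.pi μ ≤ Measure.pi ν := by
  refine Measure.le_iff.2 fun s hs => ?_
  rw [Measure.pi, Measure.pi, toMeasure_apply _ _ hs, toMeasure_apply _ _ hs]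
  refine OuterMeasure.le_pi.2 (fun t _ => ?_) s
  exact (OuterMeasure.pi_pi_le _ t).trans (Finset.prod_le_prod' fun i _ => h i (t i))

theorem pi_smul_const (μ : ∀ i, Measure (X i)) [∀ i, IsFiniteMeasure (μ i)] (K : ι → ℝ≥0∞)
    (hK : ∀ i, K i ≠ ∞) :
    Measure.pi (fun i => K i • μ i) = (∏ i, K i) • Measure.pi μ := by
  have : ∀ i, IsFiniteMeasure (K i • μ i) := fun i => Measure.smul_finite _ (hK i)
  refine Measure.pi_eq fun s _ => ?_
  simp [Measure.pi_pi, Finset.prod_mul_distrib]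

end ProductMeasures

/-! ### The law of one amplitude under translation -/

section Amplitudes

variable {p : ℝ → ℝ} {c : ℝ}

/-- The density ratio `p (w + t) / p w` is controlled by the one-sided derivative bound. -/
theorem IsAmplitudeDensity.ofReal_shift_le (hp : IsAmplitudeDensity p c) :
    ∃ κ > 0, ∀ T t w : ℝ, κ * T < 1 → 0 ≤ t → t ≤ T → T < w + t → w + t ≠ c →
      ENNReal.ofReal (p (w + t)) ≤ ENNReal.ofReal (1 - κ * T)⁻¹ * ENNReal.ofReal (p w) := by
  obtain ⟨pmin, pmax, hmin, hb⟩ := hp.bounds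
  obtain ⟨C, hC⟩ := hp.deriv_bound
  -- Over a step `t ≤ T` inside `(0, c)` the density rises by at most `|C| T ≤ κ T p (w + t)`, since
  -- `pmin ≤ p (w + t)`. The `+ 1` keeps `κ` positive.
  refine ⟨(|C| + 1) / pmin, by positivity, fun T t w hT ht htT hw hwc => ?_⟩
  have hw0 : 0 < w := by linarith
  rcases lt_or_gt_of_ne hwc with hlt | hgt
  · have hwI : w ∈ Set.Ioo 0 c := ⟨hw0, by linarith⟩
    have hwtI : w + t ∈ Set.Ioo 0 c := ⟨by linarith, hlt⟩
    have hmv : p (w + t) - p w ≤ C * ((w + t) - w) :=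
      (convex_Ioo 0 c).image_sub_le_mul_sub_of_deriv_le
        (fun x hx => (hC x hx).1.continuousAt.continuousWithinAt)
        (fun x hx => (hC x (interior_subset hx)).1.differentiableWithinAt)
        (fun x hx => (hC x (interior_subset hx)).2) w hwI _ hwtI (by linarith)
    have h1 : C * ((w + t) - w) ≤ (|C| + 1) * T := by
      have : C * t ≤ |C| * t := by gcongr; exact le_abs_self C
      nlinarith [abs_nonneg C]
    have h2 : (|C| + 1) * T ≤ (|C| + 1) / pmin * T * p (w + t) := by
      have h3 : 1 ≤ p (w + t) / pmin := (one_le_div hmin).2 (hb _ hwtI).1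
      have h4 : 0 ≤ (|C| + 1) * T := mul_nonneg (by positivity) (by linarith)
      calc (|C| + 1) * T = (|C| + 1) * T * 1 := by ring
        _ ≤ (|C| + 1) * T * (p (w + t) / pmin) := by gcongr
        _ = _ := by ring
    rw [← ENNReal.ofReal_mul (by rw [inv_nonneg]; linarith)]
    refine ENNReal.ofReal_le_ofReal ?_
    rw [inv_mul_eq_div, le_div_iff₀ (by linarith)]
    linarith
  · rw [hp.support (w + t) (fun h => h.2.not_gt hgt), ENNReal.ofReal_zero]
    exact zero_le

/-- The law of a single amplitude. -/
noncomputable def amplitudeLaw (p : ℝ → ℝ) : Measure ℝ :=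
  volume.withDensity (fun t => ENNReal.ofReal (p t))

/-- Moving an amplitude down is cheap, because an upper bound on `p'` prevents `p` from being much
larger at `w + t` than at `w`. Starting above `T ≥ t` keeps the moved amplitude positive. -/
theorem IsAmplitudeDensity.map_shift_le (hp : IsAmplitudeDensity p c) :
    ∃ κ > 0, ∀ T t : ℝ, κ * T < 1 → 0 ≤ t → t ≤ T →
      ((amplitudeLaw p).restrict (Set.Ioi T)).map (fun v => v - t)
        ≤ ENNReal.ofReal (1 - κ * T)⁻¹ • amplitudeLaw p := by
  obtain ⟨κ, hκ, h⟩ := hp.ofReal_shift_le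
  refine ⟨κ, hκ, fun T t hT ht htT => Measure.le_iff.2 fun s hs => ?_⟩
  have hm : Measurable (fun v : ℝ => v - t) := by fun_prop
  rw [Measure.map_apply hm hs, Measure.restrict_apply (hm hs), Measure.smul_apply, amplitudeLaw,
    withDensity_apply _ ((hm hs).inter measurableSet_Ioi), withDensity_apply _ hs,
    ← lintegral_indicator ((hm hs).inter measurableSet_Ioi), ← lintegral_indicator hs,
    ← lintegral_add_right_eq_self _ t, smul_eq_mul,
    ← lintegral_const_mul' _ _ ENNReal.ofReal_ne_top]
  refine lintegral_mono_ae ?_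
  -- The value of `p` at the endpoint `c` is not controlled, but this concerns a null set.
  have hne : ∀ᵐ w : ℝ, w ≠ c - t := Measure.ae_ne volume (c - t)
  filter_upwards [hne] with w hw
  by_cases hmem : w + t ∈ (fun v : ℝ => v - t) ⁻¹' s ∩ Set.Ioi T
  · have hws : w ∈ s := by simpa using hmem.1
    rw [Set.indicator_of_mem hmem, Set.indicator_of_mem hws]
    exact h T t w hT ht htT hmem.2 (fun h => hw (by linarith))
  · rw [Set.indicator_of_notMem hmem]
    exact zero_le

theorem IsAmplitudeDensity.law_Iic_le (hp : IsAmplitudeDensity p c) :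
    ∃ M > 0, ∀ T : ℝ, amplitudeLaw p (Set.Iic T) ≤ ENNReal.ofReal (M * T) := by
  obtain ⟨pmin, pmax, hmin, hb⟩ := hp.bounds
  refine ⟨|pmax| + 1, by positivity, fun T => ?_⟩
  rw [amplitudeLaw, withDensity_apply _ measurableSet_Iic, ← lintegral_indicator measurableSet_Iic]
  have h1 : ∫⁻ t, (Set.Iic T).indicator (fun t => ENNReal.ofReal (p t)) t ≤
      ∫⁻ t, (Set.Icc 0 T).indicator (fun _ => ENNReal.ofReal (|pmax| + 1)) t := by
    refine lintegral_mono_ae ?_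
    filter_upwards [Measure.ae_ne volume 0, Measure.ae_ne volume c] with t h0 hc
    by_cases ht : t ∈ Set.Ioo 0 c
    · by_cases htT : t ≤ T
      · rw [Set.indicator_of_mem (Set.mem_Iic.2 htT),
          Set.indicator_of_mem (Set.mem_Icc.2 ⟨ht.1.le, htT⟩)]
        exact ENNReal.ofReal_le_ofReal (((hb t ht).2.trans (le_abs_self _)).trans (by linarith))
      · rw [Set.indicator_of_notMem (by simpa using htT)]
        exact zero_le
    · have : p t = 0 := hp.support t fun h =>
        ht ⟨lt_of_le_of_ne h.1 (Ne.symm h0), lt_of_le_of_ne h.2 hc⟩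
      simp [Set.indicator, this]
  refine h1.trans ?_
  rw [lintegral_indicator_const measurableSet_Icc, Real.volume_Icc, sub_zero,
    ENNReal.ofReal_mul (by positivity)]

theorem IsAmplitudeDensity.law_Iio_zero (hp : IsAmplitudeDensity p c) :
    amplitudeLaw p (Set.Iio 0) = 0 := by
  rw [amplitudeLaw, withDensity_apply _ measurableSet_Iio]
  refine (setLIntegral_congr_fun measurableSet_Iio fun t ht => ?_).trans lintegral_zero
  have ht0 : t < 0 := ht
  simp [hp.support t fun h => h.1.not_gt ht0]

end Amplitudes

/-! ### Sets that are thin along the direction `1_Q` -/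

section Shift

variable {ι : Type*} {Q : Finset ι}

/-- The configuration of amplitudes `v` increased by `t` on `Q`. -/
noncomputable def shiftOn (Q : Finset ι) (t : ℝ) (v : ι → ℝ) : ι → ℝ :=
  fun i => v i + (Q : Set ι).indicator (fun _ => t) i

theorem shiftOn_apply_of_mem {i : ι} (hi : i ∈ Q) (t : ℝ) (v : ι → ℝ) :
    shiftOn Q t v i = v i + t := by
  simp [shiftOn, hi]

theorem shiftOn_apply_of_notMem {i : ι} (hi : i ∉ Q) (t : ℝ) (v : ι → ℝ) :
    shiftOn Q t v i = v i := by
  simp [shiftOn, hi]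

theorem shiftOn_shiftOn (t s : ℝ) (v : ι → ℝ) :
    shiftOn Q s (shiftOn Q t v) = shiftOn Q (t + s) v := by
  funext i
  by_cases hi : i ∈ Q
  · simp only [shiftOn_apply_of_mem hi]; ring
  · simp only [shiftOn_apply_of_notMem hi]

theorem measurable_shiftOn (t : ℝ) : Measurable (shiftOn Q t) :=
  measurable_pi_lambda _ fun i => (measurable_pi_apply i).add_const _

/-- The domination `hμ` multiplies over the coordinates in `Q`, and `hST` allows restricting these
to the half-line where it holds. The preimage is `S` moved down by `t` along `Q`. -/
theorem measure_le_measure_shift [Fintype ι] {μ : Measure ℝ} [IsProbabilityMeasure μ] {K : ℝ≥0∞}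
    (hK : K ≠ ∞) {T t : ℝ}
    (hμ : (μ.restrict (Set.Ioi T)).map (fun v => v - t) ≤ K • μ)
    {S : Set (ι → ℝ)} (hS : MeasurableSet S) (hST : ∀ v ∈ S, ∀ i ∈ Q, T < v i) :
    Measure.pi (fun _ : ι => μ) S
      ≤ K ^ Q.card * Measure.pi (fun _ : ι => μ) (shiftOn Q t ⁻¹' S) := by
  classical
  let s : ι → Set ℝ := fun i => if i ∈ Q then Set.Ioi T else Set.univ
  let f : ι → ℝ → ℝ := fun i v => if i ∈ Q then v - t else v
  have hf : ∀ i, Measurable (f i) := fun i => by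
    by_cases hi : i ∈ Q <;> simp only [f, hi, if_true, if_false] <;> fun_prop
  have hle : ∀ i, (μ.restrict (s i)).map (f i) ≤ (if i ∈ Q then K else 1) • μ := by
    intro i
    by_cases hi : i ∈ Q
    · simpa only [s, f, hi, if_true] using hμ
    · simp only [s, f, hi, if_false, Measure.restrict_univ, one_smul]
      exact (Measure.map_id' (μ := μ)).le
  have hSs : S ⊆ Set.univ.pi s := by
    intro v hv i _
    by_cases hi : i ∈ Q
    · simpa only [s, hi, if_true, Set.mem_Ioi] using hST v hv i hi
    · simp only [s, hi, if_false, Set.mem_univ]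
  have hpre : (fun (v : ι → ℝ) i => f i (v i)) ⁻¹' (shiftOn Q t ⁻¹' S) = S := by
    ext v
    have : shiftOn Q t (fun i => f i (v i)) = v := by
      funext i
      by_cases hi : i ∈ Q
      · simp [shiftOn_apply_of_mem hi, f, hi]
      · simp [shiftOn_apply_of_notMem hi, f, hi]
    simp [Set.mem_preimage, this]
  have hfin : ∀ i, IsFiniteMeasure ((μ.restrict (s i)).map (f i)) := fun i => inferInstance
  calc Measure.pi (fun _ : ι => μ) S
      = (Measure.pi (fun _ : ι => μ)).restrict (Set.univ.pi s) S := by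
        rw [Measure.restrict_apply hS, Set.inter_eq_left.2 hSs]
    _ = Measure.pi (fun i => μ.restrict (s i)) S := by rw [Measure.restrict_pi_pi]
    _ = (Measure.pi (fun i => μ.restrict (s i))).map (fun v i => f i (v i))
          (shiftOn Q t ⁻¹' S) := by
        have hmeas : Measurable (fun (v : ι → ℝ) i => f i (v i)) :=
          measurable_pi_lambda _ fun i => (hf i).comp (measurable_pi_apply i)
        rw [Measure.map_apply hmeas (measurable_shiftOn t hS), hpre]
    _ = Measure.pi (fun i => (μ.restrict (s i)).map (f i)) (shiftOn Q t ⁻¹' S) := by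
        rw [Measure.pi_map_pi fun i => (hf i).aemeasurable]
    _ ≤ Measure.pi (fun i => (if i ∈ Q then K else 1) • μ) (shiftOn Q t ⁻¹' S) :=
        pi_le_pi hle _
    _ = _ := by
        rw [pi_smul_const _ _ (fun i => by split_ifs; exacts [hK, ENNReal.one_ne_top])]
        simp

/-- If the translates of `S` by multiples of `τ` along `Q` are disjoint, then `S` is small. -/
theorem natCast_mul_measure_le [Fintype ι] {μ : Measure ℝ} [IsProbabilityMeasure μ] {K : ℝ≥0∞}
    (hK : K ≠ ∞) {T τ : ℝ} {m : ℕ}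
    (hμ : ∀ k < m, (μ.restrict (Set.Ioi T)).map (fun v => v - k * τ) ≤ K • μ)
    {S R : Set (ι → ℝ)} (hS : MeasurableSet S) (hST : ∀ v ∈ S, ∀ i ∈ Q, T < v i)
    (hdisj : ∀ v ∈ S, ∀ t, τ ≤ t → shiftOn Q t v ∉ S) (hτ : 0 ≤ τ)
    (hR : ∀ k < m, shiftOn Q (k * τ) ⁻¹' S ⊆ R) :
    (m : ℝ≥0∞) * Measure.pi (fun _ : ι => μ) S
      ≤ K ^ Q.card * Measure.pi (fun _ : ι => μ) R := by
  set π := Measure.pi (fun _ : ι => μ)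
  have hd : ∀ k l : ℕ, k < l →
      Disjoint (shiftOn Q (k * τ) ⁻¹' S) (shiftOn Q (l * τ) ⁻¹' S) := by
    intro k l hkl
    rw [Set.disjoint_left]
    intro v hk hl
    refine hdisj _ hk ((l : ℝ) * τ - k * τ) ?_ ?_
    · have : (k : ℝ) + 1 ≤ l := by exact_mod_cast hkl
      nlinarith
    · rw [shiftOn_shiftOn]
      rw [add_sub_cancel]
      exact hl
  calc (m : ℝ≥0∞) * π S = ∑ k ∈ Finset.range m, π S := by simp
    _ ≤ ∑ k ∈ Finset.range m, K ^ Q.card * π (shiftOn Q (k * τ) ⁻¹' S) :=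
        Finset.sum_le_sum fun k hk =>
          measure_le_measure_shift hK (hμ k (Finset.mem_range.1 hk)) hS hST
    _ = K ^ Q.card * π (⋃ k ∈ Finset.range m, shiftOn Q (k * τ) ⁻¹' S) := by
        rw [← Finset.mul_sum, measure_biUnion_finset]
        · intro k _ l _ hkl
          rcases lt_or_gt_of_ne hkl with h | h
          exacts [hd k l h, (hd l k h).symm]
        · exact fun k _ => measurable_shiftOn _ hS
    _ ≤ K ^ Q.card * π R := by
        gcongr
        exact Set.iUnion₂_subset fun k hk => hR k (Finset.mem_range.1 hk)

theorem measure_exists_le_le [Fintype ι] {μ : Measure ℝ} [IsProbabilityMeasure μ] {M T : ℝ}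
    (hμ : μ (Set.Iic T) ≤ ENNReal.ofReal (M * T)) :
    Measure.pi (fun _ : ι => μ) {v | ∃ i ∈ Q, v i ≤ T} ≤ Q.card * ENNReal.ofReal (M * T) := by
  have : {v : ι → ℝ | ∃ i ∈ Q, v i ≤ T} = ⋃ i ∈ Q, Function.eval i ⁻¹' Set.Iic T := by
    ext v; simp
  rw [this]
  refine (measure_biUnion_finset_le _ _).trans ?_
  rw [← nsmul_eq_mul]
  refine Finset.sum_le_card_nsmul _ _ _ fun i _ => ?_
  rw [(measurePreserving_eval (fun _ : ι => μ) i).measure_preimage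
    measurableSet_Iic.nullMeasurableSet]
  exact hμ

/-- Bernoulli's inequality: `(1 - x)^n ≥ 1 - n x ≥ 1 / 2`. -/
theorem inv_one_sub_pow_le_two {x : ℝ} {n : ℕ} (hx : 0 ≤ x) (h : (n + 1) * x ≤ 1 / 2) :
    ENNReal.ofReal (1 - x)⁻¹ ^ n ≤ 2 := by
  have hx1 : x ≤ 1 / 2 := by nlinarith [mul_nonneg (Nat.cast_nonneg (α := ℝ) n) hx]
  have h1 := one_add_mul_le_pow (a := -x) (by linarith) n
  have h2 : 1 / 2 ≤ (1 - x) ^ n := by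
    rw [sub_eq_add_neg]
    refine le_trans ?_ h1
    linarith
  rw [← ENNReal.ofReal_pow (by rw [inv_nonneg]; linarith), inv_pow, ← ENNReal.ofReal_ofNat]
  refine ENNReal.ofReal_le_ofReal ?_
  rw [inv_le_comm₀ (by linarith) two_pos]
  linarith

/-- A set of amplitudes that meets every line in the direction of `1_Q` in a set of diameter at
most `h` has probability `O(h ^ (2 / 3))`. -/
theorem IsAmplitudeDensity.exists_measure_le {p : ℝ → ℝ} {c : ℝ} (hp : IsAmplitudeDensity p c) :
    ∃ C > 0, ∀ {ι : Type} [Fintype ι] (Q : Finset ι), IsProbabilityMeasure (amplitudeLaw p) →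
      ∀ (S : Set (ι → ℝ)), MeasurableSet S → ∀ h : ℝ, 0 < h →
      (∀ v ∈ S, ∀ t, h < t → shiftOn Q t v ∉ S) →
      Measure.pi (fun _ : ι => amplitudeLaw p) S
        ≤ ENNReal.ofReal (C * (Q.card + 1) ^ 2 * h ^ (2 / 3 : ℝ)) := by
  obtain ⟨κ, hκ, hshift⟩ := hp.map_shift_le
  obtain ⟨M, hM, hIic⟩ := hp.law_Iic_le
  -- `12 M + 2` collects the three pieces of `S` below; `64 κ²` makes the bound exceed `1` when `h`
  -- is too large for the translation argument.
  refine ⟨12 * M + 64 * κ ^ 2 + 2, by positivity, fun {ι} _ Q hprob S hS h hh hdisj => ?_⟩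
  set π := Measure.pi (fun _ : ι => amplitudeLaw p) with hπ
  set n : ℕ := Q.card with hn
  have hn0 : (0 : ℝ) ≤ n := Nat.cast_nonneg n
  -- In terms of `θ = h^(1/3)` the two scales are `T₁ ≈ θ²` and `T₂ ≈ θ`, and each piece of `S` must
  -- be `O(θ²)`.
  obtain ⟨θ, hθ, hθ3, hθ2⟩ : ∃ θ > 0, h = θ ^ 3 ∧ h ^ (2 / 3 : ℝ) = θ ^ 2 := by
    refine ⟨h ^ (1 / 3 : ℝ), by positivity, ?_, ?_⟩
    · rw [← Real.rpow_natCast, ← Real.rpow_mul hh.le]; norm_num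
    · rw [← Real.rpow_natCast, ← Real.rpow_mul hh.le]; norm_num
  rw [hθ2]
  by_cases hbig : 1 < θ ∨ 1 < 8 * κ * (n + 1) * θ
  · refine prob_le_one.trans ?_
    rw [← ENNReal.ofReal_one]
    refine ENNReal.ofReal_le_ofReal ?_
    have hA : 1 ≤ ((n : ℝ) + 1) ^ 2 := one_le_pow₀ (by linarith)
    rcases hbig with h1 | h1
    · have h2 : 1 ≤ θ ^ 2 := one_le_pow₀ h1.le
      have h3 : 1 ≤ 12 * M + 64 * κ ^ 2 + 2 := by nlinarith [sq_nonneg κ]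
      calc (1 : ℝ) = 1 * 1 * 1 := by ring
        _ ≤ _ := by gcongr
    · have h2 : 1 ≤ (8 * κ * (n + 1) * θ) ^ 2 := one_le_pow₀ h1.le
      have h3 : (64 * κ ^ 2) * ((n : ℝ) + 1) ^ 2 * θ ^ 2
        ≤ (12 * M + 64 * κ ^ 2 + 2) * ((n : ℝ) + 1) ^ 2 * θ ^ 2 := by gcongr; linarith
      calc (1 : ℝ) ≤ (64 * κ ^ 2) * ((n : ℝ) + 1) ^ 2 * θ ^ 2 := by linarith
        _ ≤ _ := h3
  push Not at hbig
  obtain ⟨hθ1, hθκ⟩ := hbig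
  -- Steps of length `2 h` meet the strict inequality in `hdisj`, and a total displacement of at
  -- most `4 θ` keeps the accumulated density factor below `2`.
  have step : ∀ (m : ℕ) (S' R : Set (ι → ℝ)), m * (2 * h) ≤ 4 * θ → MeasurableSet S' → S' ⊆ S →
      (∀ v ∈ S', ∀ i ∈ Q, m * (2 * h) < v i) →
      (∀ k < m, shiftOn Q (k * (2 * h)) ⁻¹' S' ⊆ R) →
      (m : ℝ) * π.real S' ≤ 2 * π.real R := by
    intro m S' R hm hS' hSS' hT hR
    set T : ℝ := m * (2 * h)
    have hT0 : 0 ≤ T := by positivity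
    have hκT : (n + 1) * (κ * T) ≤ 1 / 2 := by
      have : (n + 1) * (κ * T) ≤ (n + 1) * (κ * (4 * θ)) := by gcongr
      linarith
    have hκT1 : κ * T < 1 := by
      have := mul_nonneg hn0 (mul_nonneg hκ.le hT0)
      linarith
    have h1 := natCast_mul_measure_le (Q := Q) (μ := amplitudeLaw p) (T := T) (τ := 2 * h) (m := m)
      (R := R) ENNReal.ofReal_ne_top
      (fun k hk => hshift T (k * (2 * h)) hκT1 (by positivity) (by
        have : (k : ℝ) ≤ m := by exact_mod_cast hk.le
        show (k : ℝ) * (2 * h) ≤ m * (2 * h)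
        gcongr)) hS' hT
      (fun v hv t ht hmem => hdisj v (hSS' hv) t (by linarith) (hSS' hmem)) (by positivity) hR
    have h2 : (m : ℝ≥0∞) * π S' ≤ 2 * π R :=
      h1.trans (by gcongr; exact inv_one_sub_pow_le_two (by positivity) hκT)
    have h3 := ENNReal.toReal_mono (by finiteness) h2
    simpa [ENNReal.toReal_mul, Measure.real] using h3
  have hlow : ∀ T : ℝ, 0 ≤ T → π.real {v | ∃ i ∈ Q, v i ≤ T} ≤ n * (M * T) := by
    intro T hT
    have h1 := ENNReal.toReal_mono (by finiteness) (measure_exists_le_le (Q := Q) (hIic T))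
    simpa [ENNReal.toReal_mul, Measure.real, ENNReal.toReal_ofReal, mul_nonneg hM.le hT] using h1
  have hms : ∀ T : ℝ, MeasurableSet {v : ι → ℝ | ∃ i ∈ Q, v i ≤ T} := by
    intro T
    have : {v : ι → ℝ | ∃ i ∈ Q, v i ≤ T} = ⋃ i ∈ Q, Function.eval i ⁻¹' Set.Iic T := by
      ext v; simp
    rw [this]
    exact Finset.measurableSet_biUnion _ fun i _ => measurable_pi_apply i measurableSet_Iic
  set m₁ : ℕ := ⌈1 / θ⌉₊ with hm₁
  set m₂ : ℕ := ⌈1 / θ ^ 2⌉₊ with hm₂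
  have hm₁l : 1 / θ ≤ m₁ := Nat.le_ceil _
  have hm₂l : 1 / θ ^ 2 ≤ m₂ := Nat.le_ceil _
  have hm₁u : (m₁ : ℝ) < 1 / θ + 1 := Nat.ceil_lt_add_one (by positivity)
  have hm₂u : (m₂ : ℝ) < 1 / θ ^ 2 + 1 := Nat.ceil_lt_add_one (by positivity)
  set T₁ : ℝ := m₁ * (2 * h) with hT₁
  set T₂ : ℝ := m₂ * (2 * h) with hT₂
  have hT₁0 : 0 ≤ T₁ := by positivity
  have hT₂0 : 0 ≤ T₂ := by positivity
  have hsq : θ ^ 2 ≤ θ := by nlinarith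
  have hcu : θ ^ 3 ≤ θ ^ 2 := by nlinarith [sq_nonneg θ]
  have hT₁4 : T₁ ≤ 4 * θ ^ 2 := by
    have : T₁ ≤ (1 / θ + 1) * (2 * θ ^ 3) := by rw [hT₁, hθ3]; gcongr
    have h2 : (1 / θ + 1) * (2 * θ ^ 3) = 2 * θ ^ 2 + 2 * θ ^ 3 := by field_simp
    linarith
  have hT₂4 : T₂ ≤ 4 * θ := by
    have : T₂ ≤ (1 / θ ^ 2 + 1) * (2 * θ ^ 3) := by rw [hT₂, hθ3]; gcongr
    have h2 : (1 / θ ^ 2 + 1) * (2 * θ ^ 3) = 2 * θ + 2 * θ ^ 3 := by field_simp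
    linarith
  -- Points of `S₁` retain an amplitude at most `T₂` when moved down, so all `m₁` translates lie in
  -- an event of probability `O(θ)`; this gain turns the exponent `1 / 2` into `2 / 3`. For `S₂`
  -- there is no such gain, but there is room for `m₂ ≈ θ⁻²` translates.
  set S₁ : Set (ι → ℝ) := (S \ {v | ∃ i ∈ Q, v i ≤ T₁}) ∩ {v | ∃ i ∈ Q, v i ≤ T₂} with hS₁
  set S₂ : Set (ι → ℝ) := S \ {v | ∃ i ∈ Q, v i ≤ T₂} with hS₂
  have b₁ : (m₁ : ℝ) * π.real S₁ ≤ 2 * π.real {v | ∃ i ∈ Q, v i ≤ T₂} := by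
    refine step m₁ S₁ _ (by linarith) (((hS.diff (hms _))).inter (hms _))
      (fun v hv => hv.1.1) (fun v hv i hi => ?_) (fun k _ v hv => ?_)
    · by_contra! hcon
      exact hv.1.2 ⟨i, hi, hcon⟩
    · obtain ⟨i, hi, hle⟩ := hv.2
      refine ⟨i, hi, ?_⟩
      rw [shiftOn_apply_of_mem hi] at hle
      have : 0 ≤ (k : ℝ) * (2 * h) := by positivity
      linarith
  have b₂ : (m₂ : ℝ) * π.real S₂ ≤ 2 * π.real Set.univ := by
    refine step m₂ S₂ _ (by linarith) (hS.diff (hms _))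
      (fun v hv => hv.1) (fun v hv i hi => ?_) (fun k _ v _ => Set.mem_univ _)
    by_contra! hcon
    exact hv.2 ⟨i, hi, hcon⟩
  have c₁ : π.real S₁ ≤ 8 * n * M * θ ^ 2 := by
    have h1 := hlow T₂ hT₂0
    have h2 : (n : ℝ) * (M * T₂) ≤ n * (M * (4 * θ)) := by gcongr
    have h3 : 1 / θ * π.real S₁ ≤ m₁ * π.real S₁ := by gcongr
    have h4 : 1 / θ * π.real S₁ ≤ 2 * (n * (M * (4 * θ))) := by linarith
    rw [one_div, inv_mul_le_iff₀ hθ] at h4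
    linarith
  have c₂ : π.real S₂ ≤ 2 * θ ^ 2 := by
    have h3 : 1 / θ ^ 2 * π.real S₂ ≤ m₂ * π.real S₂ := by gcongr
    rw [probReal_univ] at b₂
    have h4 : 1 / θ ^ 2 * π.real S₂ ≤ 2 := by linarith
    rw [one_div, inv_mul_le_iff₀ (by positivity)] at h4
    linarith
  have c₀ : π.real {v | ∃ i ∈ Q, v i ≤ T₁} ≤ 4 * n * M * θ ^ 2 := by
    have h1 := hlow T₁ hT₁0
    have h2 : (n : ℝ) * (M * T₁) ≤ n * (M * (4 * θ ^ 2)) := by gcongr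
    linarith
  have hsub : S ⊆ {v | ∃ i ∈ Q, v i ≤ T₁} ∪ (S₁ ∪ S₂) := by
    intro v hv
    by_cases h1 : v ∈ {v : ι → ℝ | ∃ i ∈ Q, v i ≤ T₁}
    · exact Or.inl h1
    · by_cases h2 : v ∈ {v : ι → ℝ | ∃ i ∈ Q, v i ≤ T₂}
      exacts [Or.inr (Or.inl ⟨⟨hv, h1⟩, h2⟩), Or.inr (Or.inr ⟨hv, h2⟩)]
  have htot : π.real S ≤ (12 * n * M + 2) * θ ^ 2 := by
    have h1 : π.real S ≤ _ := measureReal_mono hsub (by finiteness)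
    have h2 := measureReal_union_le (μ := π) {v | ∃ i ∈ Q, v i ≤ T₁} (S₁ ∪ S₂)
    have h3 := measureReal_union_le (μ := π) S₁ S₂
    linarith
  rw [← ofReal_measureReal (by finiteness)]
  refine ENNReal.ofReal_le_ofReal (htot.trans ?_)
  gcongr
  nlinarith [sq_nonneg κ, mul_nonneg hn0 hM.le, mul_nonneg hn0 (sq_nonneg κ),
    mul_nonneg (mul_nonneg hn0 hn0) hM.le, mul_nonneg (mul_nonneg hn0 hn0) (sq_nonneg κ)]

end Shift

/-! ### The space `H¹₀` as a closed space of pairs -/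

section Sobolev

variable {N d : ℕ} (Λ : Set (Config N d))

/-- The vector space `C_c^∞(Λ)`. -/
def testSubmodule : Submodule ℂ (Config N d → ℂ) where
  carrier := {g | IsTestFunction Λ g}
  zero_mem' := ⟨contDiff_const, HasCompactSupport.zero,
    by simp [tsupport, Function.support_zero]⟩
  add_mem' {f g} hf hg := ⟨hf.1.add hg.1, hf.2.1.add hg.2.1,
    (tsupport_add f g).trans (Set.union_subset hf.2.2 hg.2.2)⟩
  smul_mem' c g hg := ⟨contDiff_const.smul hg.1, hg.2.1.smul_left (f := fun _ => c),
    (closure_mono (Function.support_const_smul_subset c g)).trans hg.2.2⟩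

variable {Λ}

theorem IsTestFunction.contDiff_one {g : Config N d → ℂ} (hg : IsTestFunction Λ g) :
    ContDiff ℝ 1 g := hg.1.of_le (by exact_mod_cast le_top)

theorem IsTestFunction.differentiable {g : Config N d → ℂ} (hg : IsTestFunction Λ g) :
    Differentiable ℝ g := hg.contDiff_one.differentiable one_ne_zero

theorem IsTestFunction.continuous_partialDeriv {g : Config N d → ℂ} (hg : IsTestFunction Λ g)
    (j : Fin N) (k : Fin d) : Continuous (partialDeriv g j k) :=
  (hg.contDiff_one.continuous_fderiv one_ne_zero).clm_apply continuous_const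

theorem IsTestFunction.hasCompactSupport_partialDeriv {g : Config N d → ℂ}
    (hg : IsTestFunction Λ g) (j : Fin N) (k : Fin d) :
    HasCompactSupport (partialDeriv g j k) :=
  hg.2.1.fderiv_apply ℝ _

theorem IsTestFunction.memLp {g : Config N d → ℂ} (hg : IsTestFunction Λ g) :
    MemLp g 2 (volume.restrict Λ) :=
  hg.1.continuous.memLp_of_hasCompactSupport hg.2.1

theorem IsTestFunction.memLp_partialDeriv {g : Config N d → ℂ} (hg : IsTestFunction Λ g)
    (j : Fin N) (k : Fin d) : MemLp (partialDeriv g j k) 2 (volume.restrict Λ) :=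
  (hg.continuous_partialDeriv j k).memLp_of_hasCompactSupport (hg.hasCompactSupport_partialDeriv j k)

variable (Λ)

/-- The space of vector fields in `L²(Λ)`. -/
abbrev L2Field : Type := PiLp 2 (fun _ : Fin N × Fin d => L2 Λ)

/-- Pairs of a function and a vector field in `L²(Λ)`. -/
abbrev L2Jet : Type := WithLp 2 (L2 Λ × L2Field Λ)

variable {Λ} in
/-- The pair of `u` and `G` as an element of the Hilbert space `L2Jet Λ`. -/
noncomputable def mkJet (u : L2 Λ) (G : Fin N → Fin d → L2 Λ) : L2Jet Λ :=
  WithLp.toLp 2 (u, WithLp.toLp 2 fun jk => G jk.1 jk.2)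

/-- A test function and its gradient as an element of `L2Jet Λ`. -/
noncomputable def jet : testSubmodule Λ →ₗ[ℂ] L2Jet Λ where
  toFun g := mkJet (g.2.memLp.toLp g.1) fun j k => (g.2.memLp_partialDeriv j k).toLp _
  map_add' f g := by
    refine congrArg (WithLp.toLp 2) (Prod.ext rfl (congrArg (WithLp.toLp 2) (funext fun jk => ?_)))
    change _ = MemLp.toLp _ (IsTestFunction.memLp_partialDeriv f.2 jk.1 jk.2)
      + MemLp.toLp _ (IsTestFunction.memLp_partialDeriv g.2 jk.1 jk.2)
    rw [← MemLp.toLp_add]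
    refine MemLp.toLp_congr _ _ (Eventually.of_forall fun z => ?_)
    have h := fderiv_add (f.2.differentiable z) (g.2.differentiable z)
    change fderiv ℝ (f.1 + g.1) z _ = _
    rw [h]
    rfl
  map_smul' c g := by
    refine congrArg (WithLp.toLp 2) (Prod.ext rfl (congrArg (WithLp.toLp 2) (funext fun jk => ?_)))
    change _ = c • MemLp.toLp _ (IsTestFunction.memLp_partialDeriv g.2 jk.1 jk.2)
    rw [← MemLp.toLp_const_smul]
    refine MemLp.toLp_congr _ _ (Eventually.of_forall fun z => ?_)
    have h := fderiv_const_smul (g.2.differentiable z) c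
    change fderiv ℝ (c • g.1) z _ = _
    rw [h]
    rfl

/-- The space of pairs of a function in `H¹₀(Λ)` and its gradient. -/
noncomputable def sobolevSubmodule : Submodule ℂ (L2Jet Λ) :=
  (LinearMap.range (jet Λ)).topologicalClosure

/-- The Sobolev space `H¹₀(Λ)`. -/
def Sobolev : Type := sobolevSubmodule Λ

noncomputable instance : NormedAddCommGroup (Sobolev Λ) :=
  inferInstanceAs (NormedAddCommGroup (sobolevSubmodule Λ))

noncomputable instance : InnerProductSpace ℂ (Sobolev Λ) :=
  inferInstanceAs (InnerProductSpace ℂ (sobolevSubmodule Λ))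

instance : CompleteSpace (Sobolev Λ) :=
  (Submodule.isClosed_topologicalClosure (LinearMap.range (jet Λ))).completeSpace_coe

/-- An element of `H¹₀(Λ)` together with its gradient. -/
noncomputable def toJet : Sobolev Λ →L[ℂ] L2Jet Λ := (sobolevSubmodule Λ).subtypeL

/-- The test functions as a subspace of `H¹₀(Λ)`. -/
noncomputable def testSpace : Submodule ℂ (Sobolev Λ) :=
  (LinearMap.range (jet Λ)).comap (toJet Λ).toLinearMap

/-- The embedding of `H¹₀(Λ)` in `L²(Λ)`. -/
noncomputable def toL2 : Sobolev Λ →L[ℂ] L2 Λ :=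
  WithLp.fstL 2 ℂ (L2 Λ) (L2Field Λ) ∘L toJet Λ

/-- The gradient on `H¹₀(Λ)`. -/
noncomputable def gradL2 : Sobolev Λ →L[ℂ] L2Field Λ :=
  WithLp.sndL 2 ℂ (L2 Λ) (L2Field Λ) ∘L toJet Λ

/-- A test function as an element of `H¹₀(Λ)`. -/
noncomputable def sobolevJet (g : testSubmodule Λ) : Sobolev Λ :=
  ⟨jet Λ g, Submodule.le_topologicalClosure _ ⟨g, rfl⟩⟩

variable {Λ}

theorem norm_sq_eq_toL2_add_gradL2 (x : Sobolev Λ) : ‖x‖ ^ 2 = ‖toL2 Λ x‖ ^ 2 + ‖gradL2 Λ x‖ ^ 2 :=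
  WithLp.prod_norm_sq_eq_of_L2 (toJet Λ x)

theorem mem_testSpace {x : Sobolev Λ} : x ∈ testSpace Λ ↔ ∃ g, sobolevJet Λ g = x := by
  constructor
  · rintro ⟨g, hg⟩
    exact ⟨g, Subtype.ext hg⟩
  · rintro ⟨g, rfl⟩
    exact ⟨g, rfl⟩

theorem dense_testSpace : Dense (testSpace Λ : Set (Sobolev Λ)) := by
  intro x
  have hind : Topology.IsInducing (toJet Λ) := Topology.IsInducing.subtypeVal
  rw [hind.closure_eq_preimage_closure_image]
  have h : (toJet Λ) '' (testSpace Λ : Set (Sobolev Λ))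
      = (LinearMap.range (jet Λ) : Set (L2Jet Λ)) := by
    ext y
    constructor
    · rintro ⟨z, hz, rfl⟩
      exact hz
    · intro hy
      exact ⟨⟨y, Submodule.le_topologicalClosure _ hy⟩, hy, rfl⟩
  rw [Set.mem_preimage, h]
  exact x.2

theorem tendsto_mkJet_iff {u : ℕ → L2 Λ} {G : ℕ → Fin N → Fin d → L2 Λ} {u₀ : L2 Λ}
    {G₀ : Fin N → Fin d → L2 Λ} :
    Tendsto (fun n => mkJet (u n) (G n)) atTop (𝓝 (mkJet u₀ G₀)) ↔
      Tendsto u atTop (𝓝 u₀) ∧ ∀ j k, Tendsto (fun n => G n j k) atTop (𝓝 (G₀ j k)) := by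
  constructor
  · intro h
    refine ⟨((WithLp.fstL 2 ℂ (L2 Λ) (L2Field Λ)).continuous.tendsto _).comp h, fun j k => ?_⟩
    exact (((PiLp.proj (𝕜 := ℂ) 2 (fun _ : Fin N × Fin d => L2 Λ) (j, k)).continuous.tendsto _).comp
      ((WithLp.sndL 2 ℂ (L2 Λ) (L2Field Λ)).continuous.tendsto _)).comp h
  · rintro ⟨h1, h2⟩
    refine ((WithLp.prod_continuous_toLp 2 _ _).tendsto _).comp (h1.prodMk_nhds ?_)
    exact ((PiLp.continuous_toLp 2 _).tendsto _).comp (tendsto_pi_nhds.2 fun jk => h2 jk.1 jk.2)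

theorem tendsto_toLp_iff {g : ℕ → Config N d → ℂ} (hg : ∀ n, MemLp (g n) 2 (volume.restrict Λ))
    (u : L2 Λ) : Tendsto (fun n => (hg n).toLp (g n)) atTop (𝓝 u) ↔
      Tendsto (fun n => eLpNorm (fun z => g n z - u z) 2 (volume.restrict Λ)) atTop (𝓝 0) := by
  have h := Lp.tendsto_Lp_iff_tendsto_eLpNorm'' g hg u (Lp.memLp u) (fi := atTop)
  rw [Lp.toLp_coeFn] at h
  exact h

/-- Links the sequential definition through `eLpNorm` with the closed subspace on which the Hilbert
space arguments run. -/
theorem hasH10Gradient_iff {u : L2 Λ} {G : Fin N → Fin d → L2 Λ} :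
    HasH10Gradient Λ u G ↔ mkJet u G ∈ sobolevSubmodule Λ := by
  rw [sobolevSubmodule, ← SetLike.mem_coe, Submodule.topologicalClosure_coe,
    mem_closure_iff_seq_limit]
  constructor
  · rintro ⟨g, hg, h1, h2⟩
    refine ⟨fun n => jet Λ ⟨g n, hg n⟩, fun n => ⟨_, rfl⟩, ?_⟩
    exact tendsto_mkJet_iff.2 ⟨(tendsto_toLp_iff (fun n => (hg n).memLp) u).2 h1, fun j k =>
      (tendsto_toLp_iff (fun n => (hg n).memLp_partialDeriv j k) _).2 (h2 j k)⟩
  · rintro ⟨x, hx, hlim⟩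
    choose g hg using hx
    have hlim' : Tendsto (fun n => mkJet ((g n).2.memLp.toLp (g n).1)
        fun j k => ((g n).2.memLp_partialDeriv j k).toLp _) atTop (𝓝 (mkJet u G)) := by
      convert hlim using 2 with n
      exact hg n
    obtain ⟨h1, h2⟩ := tendsto_mkJet_iff.1 hlim'
    exact ⟨fun n => (g n).1, fun n => (g n).2,
      (tendsto_toLp_iff (fun n => (g n).2.memLp) u).1 h1, fun j k =>
      (tendsto_toLp_iff (fun n => (g n).2.memLp_partialDeriv j k) _).1 (h2 j k)⟩

theorem inner_gradL2_sobolevJet (v : testSubmodule Λ) (x : Sobolev Λ) :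
    ⟪gradL2 Λ (sobolevJet Λ v), gradL2 Λ x⟫_ℂ
      = ∑ j, ∑ k, ∫ z in Λ, (gradL2 Λ x (j, k)) z * starRingEnd ℂ (partialDeriv v.1 j k z) := by
  rw [PiLp.inner_apply, Fintype.sum_prod_type]
  refine Finset.sum_congr rfl fun j _ => Finset.sum_congr rfl fun k _ => ?_
  rw [L2.inner_def]
  refine integral_congr_ae ?_
  have : (gradL2 Λ (sobolevJet Λ v) (j, k) : L2 Λ) =ᵐ[volume.restrict Λ] partialDeriv v.1 j k :=
    (v.2.memLp_partialDeriv j k).coeFn_toLp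
  filter_upwards [this] with z hz
  rw [hz, RCLike.inner_apply]

theorem inner_toL2_sobolevJet (v : testSubmodule Λ) (f : L2 Λ) :
    ⟪toL2 Λ (sobolevJet Λ v), f⟫_ℂ = ∫ z in Λ, f z * starRingEnd ℂ (v.1 z) := by
  rw [L2.inner_def]
  refine integral_congr_ae ?_
  have : (toL2 Λ (sobolevJet Λ v) : L2 Λ) =ᵐ[volume.restrict Λ] v.1 := v.2.memLp.coeFn_toLp
  filter_upwards [this] with z hz
  rw [hz, RCLike.inner_apply]

end Sobolev

/-! ### The Schrödinger form, its resolvent and its levels -/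

section Forms

variable {N d : ℕ} {Λ : Set (Config N d)} {W W' : Config N d → ℝ}

/-- Multiplication by a bounded function as an operator on `L²(Λ)`. -/
noncomputable def mulOp (hW : MemLp W ∞ (volume.restrict Λ)) : L2 Λ →L[ℂ] L2 Λ :=
  (ContinuousLinearMap.mul ℂ ℂ).holderL (volume.restrict Λ) ∞ 2 2 (hW.ofReal.toLp _)

theorem coeFn_mulOp (hW : MemLp W ∞ (volume.restrict Λ)) (u : L2 Λ) :
    mulOp hW u =ᵐ[volume.restrict Λ] fun z => (W z : ℂ) * u z := by
  have h1 := ContinuousLinearMap.coeFn_holder (B := ContinuousLinearMap.mul ℂ ℂ) (r := 2)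
    (hW.ofReal.toLp _ : Lp ℂ ∞ (volume.restrict Λ)) u
  filter_upwards [h1, (hW.ofReal (K := ℂ)).coeFn_toLp] with z h1 h2
  change ((ContinuousLinearMap.mul ℂ ℂ).holder 2 _ u) z = _
  rw [h1, h2]
  rfl

theorem inner_mulOp (hW : MemLp W ∞ (volume.restrict Λ)) (u v : L2 Λ) :
    ⟪v, mulOp hW u⟫_ℂ = ∫ z in Λ, (W z : ℂ) * u z * starRingEnd ℂ (v z) := by
  rw [L2.inner_def]
  refine integral_congr_ae ?_
  filter_upwards [coeFn_mulOp hW u] with z hz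
  rw [hz, RCLike.inner_apply]

theorem isSymmetric_mulOp (hW : MemLp W ∞ (volume.restrict Λ)) :
    (mulOp hW : L2 Λ →ₗ[ℂ] L2 Λ).IsSymmetric := by
  intro u v
  change ⟪mulOp hW u, v⟫_ℂ = ⟪u, mulOp hW v⟫_ℂ
  rw [L2.inner_def, inner_mulOp]
  refine integral_congr_ae ?_
  filter_upwards [coeFn_mulOp hW u] with z hz
  rw [hz, RCLike.inner_apply, map_mul, Complex.conj_ofReal]
  ring

theorem integrable_mul_norm_sq (hW : MemLp W ∞ (volume.restrict Λ)) (u : L2 Λ) :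
    Integrable (fun z => W z * ‖u z‖ ^ 2) (volume.restrict Λ) := by
  have h := (Lp.memLp u).integrable_norm_pow (p := 2) (by norm_num)
  exact h.mul_of_top_right hW

theorem re_inner_mulOp (hW : MemLp W ∞ (volume.restrict Λ)) (u : L2 Λ) :
    (⟪u, mulOp hW u⟫_ℂ).re = ∫ z in Λ, W z * ‖u z‖ ^ 2 := by
  have h : ⟪u, mulOp hW u⟫_ℂ = ((∫ z in Λ, W z * ‖u z‖ ^ 2 : ℝ) : ℂ) := by
    rw [inner_mulOp, ← integral_complex_ofReal]
    refine integral_congr_ae (Eventually.of_forall fun z => ?_)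
    change (W z : ℂ) * u z * starRingEnd ℂ (u z) = ((W z * ‖u z‖ ^ 2 : ℝ) : ℂ)
    rw [mul_assoc, Complex.mul_conj, Complex.normSq_eq_norm_sq]
    push_cast
    ring
  rw [h, Complex.ofReal_re]

theorem integral_norm_sq_eq (u : L2 Λ) : ∫ z in Λ, ‖u z‖ ^ 2 = ‖u‖ ^ 2 := by
  have h : ⟪u, u⟫_ℂ = ((∫ z in Λ, ‖u z‖ ^ 2 : ℝ) : ℂ) := by
    rw [L2.inner_def, ← integral_complex_ofReal]
    refine integral_congr_ae (Eventually.of_forall fun z => ?_)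
    simp [inner_self_eq_norm_sq_to_K]
  rw [inner_self_eq_norm_sq_to_K] at h
  exact (Complex.ofReal_injective (by simpa using h)).symm

/-- The quadratic form of `-(1/2)Δ + W` on `H¹₀(Λ)`. -/
noncomputable def energy (W : Config N d → ℝ) (x : Sobolev Λ) : ℝ :=
  1 / 2 * ‖gradL2 Λ x‖ ^ 2 + ∫ z in Λ, W z * ‖toL2 Λ x z‖ ^ 2

theorem energy_le_energy_add (hW : MemLp W ∞ (volume.restrict Λ))
    (hW' : MemLp W' ∞ (volume.restrict Λ)) {t : ℝ}
    (h : ∀ᵐ z ∂volume.restrict Λ, W z ≤ W' z + t) (x : Sobolev Λ) :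
    energy W x ≤ energy W' x + t * ‖toL2 Λ x‖ ^ 2 := by
  have h1 : ∫ z in Λ, W z * ‖toL2 Λ x z‖ ^ 2
      ≤ ∫ z in Λ, (W' z * ‖toL2 Λ x z‖ ^ 2 + t * ‖toL2 Λ x z‖ ^ 2) := by
    refine integral_mono_ae (integrable_mul_norm_sq hW _) ((integrable_mul_norm_sq hW' _).add
      (((Lp.memLp _).integrable_norm_pow (p := 2) (by norm_num)).const_mul t)) ?_
    filter_upwards [h] with z hz
    rw [← add_mul]
    gcongr
  rw [integral_add (integrable_mul_norm_sq hW' _)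
    (((Lp.memLp _).integrable_norm_pow (p := 2) (by norm_num)).const_mul t),
    integral_const_mul, integral_norm_sq_eq] at h1
  unfold energy
  linarith

theorem energy_add_le_energy (hW : MemLp W ∞ (volume.restrict Λ))
    (hW' : MemLp W' ∞ (volume.restrict Λ)) {t : ℝ}
    (h : ∀ᵐ z ∂volume.restrict Λ, W z + t ≤ W' z) (x : Sobolev Λ) :
    energy W x + t * ‖toL2 Λ x‖ ^ 2 ≤ energy W' x := by
  have := energy_le_energy_add hW hW' (t := -t) (h.mono fun z hz => by linarith) x
  linarith

theorem grad_le_energy (hW : ∀ᵐ z ∂volume.restrict Λ, 0 ≤ W z) (x : Sobolev Λ) :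
    1 / 2 * ‖gradL2 Λ x‖ ^ 2 ≤ energy W x := by
  have : 0 ≤ ∫ z in Λ, W z * ‖toL2 Λ x z‖ ^ 2 :=
    integral_nonneg_of_ae (hW.mono fun z hz => mul_nonneg hz (sq_nonneg _))
  unfold energy
  linarith

theorem eq_zero_of_energy_nonpos (hW : ∀ᵐ z ∂volume.restrict Λ, 0 ≤ W z) (x : Sobolev Λ)
    (h : energy W x ≤ 0) (h0 : toL2 Λ x = 0) : x = 0 := by
  have h1 := grad_le_energy hW x
  have h2 := norm_sq_eq_toL2_add_gradL2 x
  rw [h0, norm_zero] at h2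
  have h3 : ‖x‖ ^ 2 ≤ 0 := by nlinarith [sq_nonneg ‖gradL2 Λ x‖]
  simpa using le_antisymm h3 (sq_nonneg _)

theorem energy_congr (hΛ : MeasurableSet Λ) (h : Set.EqOn W W' Λ) :
    energy (Λ := Λ) W = energy W' := by
  funext x
  unfold energy
  congr 1
  exact setIntegral_congr_fun hΛ fun z hz => by simp only [h hz]

/-- The operator on `H¹₀(Λ)` that represents the sesquilinear form of `-(1/2)Δ + W - E`. -/
noncomputable def formOp (hW : MemLp W ∞ (volume.restrict Λ)) (E : ℝ) :
    Sobolev Λ →L[ℂ] Sobolev Λ :=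
  (1 / 2 : ℂ) • ((gradL2 Λ).adjoint ∘L gradL2 Λ)
    + (toL2 Λ).adjoint ∘L (mulOp hW - (E : ℂ) • ContinuousLinearMap.id ℂ (L2 Λ)) ∘L toL2 Λ

theorem inner_formOp (hW : MemLp W ∞ (volume.restrict Λ)) (E : ℝ) (y x : Sobolev Λ) :
    ⟪y, formOp hW E x⟫_ℂ = (1 / 2 : ℂ) * ⟪gradL2 Λ y, gradL2 Λ x⟫_ℂ
      + (⟪toL2 Λ y, mulOp hW (toL2 Λ x)⟫_ℂ - E * ⟪toL2 Λ y, toL2 Λ x⟫_ℂ) := by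
  simp only [formOp, add_apply, smul_apply,
    ContinuousLinearMap.comp_apply, inner_add_right, inner_smul_right,
    ContinuousLinearMap.adjoint_inner_right, sub_apply, inner_sub_right,
    ContinuousLinearMap.id_apply]

theorem isSymmetric_formOp (hW : MemLp W ∞ (volume.restrict Λ)) (E : ℝ) :
    (formOp hW E : Sobolev Λ →ₗ[ℂ] Sobolev Λ).IsSymmetric := by
  intro x y
  change ⟪formOp hW E x, y⟫_ℂ = ⟪x, formOp hW E y⟫_ℂ
  have h : ⟪toL2 Λ x, mulOp hW (toL2 Λ y)⟫_ℂ = starRingEnd ℂ ⟪toL2 Λ y, mulOp hW (toL2 Λ x)⟫_ℂ := by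
    rw [inner_conj_symm]
    exact (isSymmetric_mulOp hW _ _).symm
  rw [← inner_conj_symm, inner_formOp, inner_formOp, h, map_add, map_sub, map_mul, map_mul,
    inner_conj_symm, inner_conj_symm, Complex.conj_ofReal]
  simp [map_ofNat]

theorem re_inner_formOp (hW : MemLp W ∞ (volume.restrict Λ)) (E : ℝ) (x : Sobolev Λ) :
    (⟪x, formOp hW E x⟫_ℂ).re = energy W x - E * ‖toL2 Λ x‖ ^ 2 := by
  rw [inner_formOp, Complex.add_re, Complex.sub_re, re_inner_mulOp, inner_self_eq_norm_sq_to_K,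
    inner_self_eq_norm_sq_to_K, energy]
  norm_cast
  simp
  norm_cast
  ring

/-- Test functions are dense in `H¹₀`, so an identity between vectors there may be checked by
pairing with them, which is the weak equation. -/
theorem formOp_eq_adjoint_iff (hW : MemLp W ∞ (volume.restrict Λ)) (E : ℝ) (x : Sobolev Λ)
    (f : L2 Λ) : formOp hW E x = (toL2 Λ).adjoint f ↔
      ∀ v : Config N d → ℂ, IsTestFunction Λ v →
      (1 / 2 : ℂ) * (∑ j, ∑ k,
          (∫ z in Λ, gradL2 Λ x (j, k) z * starRingEnd ℂ (partialDeriv v j k z)))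
        + (∫ z in Λ, (W z : ℂ) * toL2 Λ x z * starRingEnd ℂ (v z))
      = (∫ z in Λ, (f + (E : ℂ) • toL2 Λ x : L2 Λ) z * starRingEnd ℂ (v z)) := by
  have key : ∀ v : testSubmodule Λ,
      (⟪sobolevJet Λ v, formOp hW E x⟫_ℂ = ⟪sobolevJet Λ v, (toL2 Λ).adjoint f⟫_ℂ) ↔
      ((1 / 2 : ℂ) * (∑ j, ∑ k,
          (∫ z in Λ, gradL2 Λ x (j, k) z * starRingEnd ℂ (partialDeriv v.1 j k z)))
        + (∫ z in Λ, (W z : ℂ) * toL2 Λ x z * starRingEnd ℂ (v.1 z))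
      = (∫ z in Λ, (f + (E : ℂ) • toL2 Λ x : L2 Λ) z * starRingEnd ℂ (v.1 z))) := by
    intro v
    have h : ∫ z in Λ, (W z : ℂ) * toL2 Λ x z * starRingEnd ℂ (v.1 z)
        = ⟪toL2 Λ (sobolevJet Λ v), mulOp hW (toL2 Λ x)⟫_ℂ := by
      rw [inner_toL2_sobolevJet]
      refine integral_congr_ae ?_
      filter_upwards [coeFn_mulOp hW (toL2 Λ x)] with z hz
      rw [hz]
    rw [inner_formOp, ContinuousLinearMap.adjoint_inner_right, ← inner_gradL2_sobolevJet, h,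
      ← inner_toL2_sobolevJet, inner_add_right, inner_smul_right, ← add_sub_assoc, sub_eq_iff_eq_add]
  constructor
  · intro h v hv
    exact (key ⟨v, hv⟩).1 (by rw [h])
  · intro h
    refine dense_testSpace.eq_of_inner_right (𝕜 := ℂ) fun v hv => ?_
    obtain ⟨g, rfl⟩ := mem_testSpace.1 hv
    exact (key g).2 (h g.1 g.2)

/-- The resolvent is `ι A⁻¹ ι*`, with `ι` the embedding `toL2` and `A` the form operator. Uniqueness
of the gradient of `u` need not be known beforehand: any admissible pair `(u, G)` solves `A x = ι*
f`, which has one solution. -/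
theorem inResolventSet_of_bijective (hW : MemLp W ∞ (volume.restrict Λ)) (E : ℝ)
    (h : Function.Bijective (formOp hW E)) : InResolventSet Λ W E := by
  let e := ContinuousLinearEquiv.ofBijective (formOp hW E) (LinearMap.ker_eq_bot.2 h.1)
    (LinearMap.range_eq_top.2 h.2)
  have he : ∀ x, e x = formOp hW E x := fun x => rfl
  refine ⟨toL2 Λ ∘L (e.symm : Sobolev Λ →L[ℂ] Sobolev Λ) ∘L (toL2 Λ).adjoint, fun u f => ?_⟩
  constructor
  · intro hu
    set x := e.symm ((toL2 Λ).adjoint f) with hx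
    have hux : toL2 Λ x = u := hu
    have hxe : formOp hW E x = (toL2 Λ).adjoint f := by rw [← he, hx, e.apply_symm_apply]
    refine ⟨fun j k => gradL2 Λ x (j, k), hasH10Gradient_iff.2 ?_, ?_⟩
    · rw [← hux]
      exact x.2
    · have := (formOp_eq_adjoint_iff hW E x f).1 hxe
      rwa [hux] at this
  · rintro ⟨G, hG, hweak⟩
    let x : Sobolev Λ := ⟨mkJet u G, hasH10Gradient_iff.1 hG⟩
    have hxe : formOp hW E x = (toL2 Λ).adjoint f := (formOp_eq_adjoint_iff hW E x f).2 hweak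
    change toL2 Λ (e.symm ((toL2 Λ).adjoint f)) = u
    rw [← hxe, ← he, e.symm_apply_apply]
    rfl

/-- The variational energy levels of `-(1/2)Δ + W` on `Λ`, truncated at `B`. -/
noncomputable def energyLevel (Λ : Set (Config N d)) (W : Config N d → ℝ) (B : ℝ) (k : ℕ) : ℝ :=
  level (testSpace Λ) (toL2 Λ) (energy W) B k

/-- Off the levels the form operator is bounded below, hence bijective by symmetry, and `E` is in
the resolvent set. Neither compactness of the embedding in `L²` nor eigenfunctions enter. -/
theorem exists_energyLevel_eq (hW : MemLp W ∞ (volume.restrict Λ)) {E Emax B : ℝ}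
    (hE : E ∈ spectrumUpTo Λ W Emax) (hB : Emax < B) {n : ℕ} (hn : Emax < energyLevel Λ W B n) :
    ∃ k < n, energyLevel Λ W B k = E := by
  by_contra! hne
  obtain ⟨hE, hE0, hEmax⟩ := hE
  refine hE (inResolventSet_of_bijective hW E ?_)
  have hgarding : ∀ x : Sobolev Λ, 1 / 2 * ‖x‖ ^ 2
      ≤ (⟪x, formOp hW E x⟫_ℂ).re + (1 / 2 + (‖mulOp hW‖ + E)) * ‖toL2 Λ x‖ ^ 2 := by
    intro x
    rw [re_inner_formOp, energy, ← re_inner_mulOp hW, norm_sq_eq_toL2_add_gradL2]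
    have h1 : -(‖mulOp hW‖ * ‖toL2 Λ x‖ ^ 2) ≤ (⟪toL2 Λ x, mulOp hW (toL2 Λ x)⟫_ℂ).re := by
      have h2 := (Complex.abs_re_le_norm _).trans
        (norm_inner_le_norm (𝕜 := ℂ) (toL2 Λ x) (mulOp hW (toL2 Λ x)))
      have h3 := (mulOp hW).le_opNorm (toL2 Λ x)
      have h4 := neg_le_of_abs_le h2
      nlinarith [norm_nonneg (toL2 Λ x)]
    nlinarith
  obtain ⟨ε, hε, hb⟩ := exists_bounded_below_of_ne_level (isSymmetric_formOp hW E) (by norm_num)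
    (by positivity) hgarding dense_testSpace hE0 (fun x => by rw [re_inner_formOp]; ring)
    (hEmax.trans_lt hB) (hEmax.trans_lt hn) hne
  exact bijective_of_isSymmetric_of_bounded_below (isSymmetric_formOp hW E) hε hb

end Forms

/-! ### A Weyl type dimension bound from averages over small boxes -/

section BoxAverages

theorem sq_lintegral_le {α : Type*} [MeasurableSpace α] (μ : Measure α) {f : α → ℝ≥0∞}
    (hf : AEMeasurable f μ) : (∫⁻ a, f a ∂μ) ^ 2 ≤ μ Set.univ * ∫⁻ a, f a ^ 2 ∂μ := by
  have h := ENNReal.lintegral_mul_le_Lp_mul_Lq μ Real.HolderConjugate.two_two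
    (aemeasurable_const (b := (1 : ℝ≥0∞))) hf
  simp only [Pi.mul_apply, one_mul, one_pow, lintegral_one, ENNReal.rpow_ofNat] at h
  calc (∫⁻ a, f a ∂μ) ^ 2
      ≤ (μ Set.univ ^ (1 / 2 : ℝ) * (∫⁻ a, f a ^ 2 ∂μ) ^ (1 / 2 : ℝ)) ^ 2 := by gcongr
    _ = _ := by
      rw [mul_pow, ← ENNReal.rpow_natCast, ← ENNReal.rpow_natCast, ← ENNReal.rpow_mul,
        ← ENNReal.rpow_mul]
      norm_num

theorem add_sq_le_two_mul (a b : ℝ≥0∞) : (a + b) ^ 2 ≤ 2 * (a ^ 2 + b ^ 2) := by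
  rcases eq_or_ne a ∞ with rfl | ha
  · simp
  rcases eq_or_ne b ∞ with rfl | hb
  · simp
  lift a to NNReal using ha
  lift b to NNReal using hb
  exact_mod_cast add_sq_le (a := a) (b := b)

variable {N d : ℕ} {Λ : Set (Config N d)}

/-- The increment is an integral of the derivative along a segment; after Cauchy–Schwarz,
translation invariance removes the dependence on the point of the segment. -/
theorem IsTestFunction.lintegral_translate_sub_sq_le {g : Config N d → ℂ}
    (hg : IsTestFunction Λ g) (y : Config N d) :
    ∫⁻ x, ‖g (x + y) - g x‖ₑ ^ 2 ≤ ∫⁻ x, ‖fderiv ℝ g x y‖ₑ ^ 2 := by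
  have hc : Continuous (fderiv ℝ g) := hg.contDiff_one.continuous_fderiv one_ne_zero
  have hpt : ∀ x, ‖g (x + y) - g x‖ₑ ^ 2
      ≤ ∫⁻ t in Set.Ioc (0 : ℝ) 1, ‖fderiv ℝ g (x + t • y) y‖ₑ ^ 2 := by
    intro x
    have hct : Continuous fun t : ℝ => fderiv ℝ g (x + t • y) y := by fun_prop
    have hd : ∀ t ∈ Set.uIcc (0 : ℝ) 1,
        HasDerivAt (fun t : ℝ => g (x + t • y)) (fderiv ℝ g (x + t • y) y) t := by
      intro t _
      have h1 : HasDerivAt (fun t : ℝ => x + t • y) y t := by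
        simpa using ((hasDerivAt_id t).smul_const y).const_add x
      exact (hg.differentiable (x + t • y)).hasFDerivAt.comp_hasDerivAt t h1
    have hftc := intervalIntegral.integral_eq_sub_of_hasDerivAt hd
      (hct.intervalIntegrable _ _)
    rw [one_smul, zero_smul, add_zero, intervalIntegral.integral_of_le zero_le_one] at hftc
    rw [← hftc]
    calc ‖∫ t in Set.Ioc (0 : ℝ) 1, fderiv ℝ g (x + t • y) y‖ₑ ^ 2
        ≤ (∫⁻ t in Set.Ioc (0 : ℝ) 1, ‖fderiv ℝ g (x + t • y) y‖ₑ) ^ 2 := by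
          gcongr
          exact enorm_integral_le_lintegral_enorm _
      _ ≤ _ := by
          refine (sq_lintegral_le _ hct.enorm.measurable.aemeasurable).trans ?_
          simp
  calc ∫⁻ x, ‖g (x + y) - g x‖ₑ ^ 2
      ≤ ∫⁻ x, ∫⁻ t in Set.Ioc (0 : ℝ) 1, ‖fderiv ℝ g (x + t • y) y‖ₑ ^ 2 := lintegral_mono hpt
    _ = ∫⁻ t in Set.Ioc (0 : ℝ) 1, ∫⁻ x, ‖fderiv ℝ g (x + t • y) y‖ₑ ^ 2 := by
        refine lintegral_lintegral_swap ?_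
        have : Continuous fun q : Config N d × ℝ => fderiv ℝ g (q.1 + q.2 • y) y := by fun_prop
        exact (this.enorm.measurable.pow_const 2).aemeasurable
    _ = ∫⁻ t in Set.Ioc (0 : ℝ) 1, ∫⁻ x, ‖fderiv ℝ g x y‖ₑ ^ 2 := by
        refine lintegral_congr fun t => ?_
        exact lintegral_add_right_eq_self (fun x => ‖fderiv ℝ g x y‖ₑ ^ 2) (t • y)
    _ = _ := by simp

theorem norm_fderiv_apply_sq_le {g : Config N d → ℂ} (x y : Config N d) {h : ℝ}
    (hy : ∀ j k, |y j k| ≤ h) :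
    ‖fderiv ℝ g x y‖ ^ 2 ≤ (N * d) * h ^ 2 * ∑ j, ∑ k, ‖partialDeriv g j k x‖ ^ 2 := by
  have hy' : y = ∑ jk : Fin N × Fin d,
      y jk.1 jk.2 • (Pi.single jk.1 (Pi.single jk.2 (1 : ℝ)) : Config N d) := by
    rw [Fintype.sum_prod_type]
    funext j k
    simp [Finset.sum_apply, Pi.single_apply, apply_ite, ite_apply]
  have h1 : ‖fderiv ℝ g x y‖ ≤ ∑ jk : Fin N × Fin d, h * ‖partialDeriv g jk.1 jk.2 x‖ := by
    conv_lhs => rw [hy', map_sum]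
    refine (norm_sum_le _ _).trans (Finset.sum_le_sum fun jk _ => ?_)
    rw [map_smul, norm_smul, Real.norm_eq_abs]
    exact mul_le_mul_of_nonneg_right (hy _ _) (norm_nonneg _)
  have h2 := sq_sum_le_card_mul_sum_sq (s := (Finset.univ : Finset (Fin N × Fin d)))
    (f := fun jk => h * ‖partialDeriv g jk.1 jk.2 x‖)
  have h3 : ‖fderiv ℝ g x y‖ ^ 2 ≤ (∑ jk : Fin N × Fin d, h * ‖partialDeriv g jk.1 jk.2 x‖) ^ 2 := by
    gcongr
  refine (h3.trans h2).trans_eq ?_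
  simp only [mul_pow, ← Finset.mul_sum, Fintype.sum_prod_type, Finset.card_univ, Fintype.card_prod,
    Fintype.card_fin]
  push_cast
  ring

/-- The cube `[0, h]^{Nd}`. -/
def box (N d : ℕ) (h : ℝ) : Set (Config N d) :=
  Set.univ.pi fun _ => Set.univ.pi fun _ => Set.Icc 0 h

theorem measurableSet_box (h : ℝ) : MeasurableSet (box N d h) :=
  MeasurableSet.univ_pi fun _ => MeasurableSet.univ_pi fun _ => measurableSet_Icc

theorem volume_box (h : ℝ) : volume (box N d h) = ENNReal.ofReal h ^ (N * d) := by
  simp only [box, volume_pi_pi, Real.volume_Icc, sub_zero, Finset.prod_const, Finset.card_univ,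
    Fintype.card_fin, ← pow_mul]
  rw [mul_comm]

theorem abs_le_of_mem_box {h : ℝ} {y : Config N d} (hy : y ∈ box N d h) (j : Fin N) (k : Fin d) :
    |y j k| ≤ h := by
  have := hy j (Set.mem_univ _) k (Set.mem_univ _)
  rw [abs_of_nonneg this.1]
  exact this.2

/-- The total squared `L²` norm of the gradient. -/
noncomputable def gradSq (g : Config N d → ℂ) : ℝ≥0∞ :=
  ∑ j, ∑ k, ∫⁻ x, ‖partialDeriv g j k x‖ₑ ^ 2

theorem IsTestFunction.lintegral_translate_le {g : Config N d → ℂ} (hg : IsTestFunction Λ g)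
    {h : ℝ} {y : Config N d} (hy : y ∈ box N d h) :
    ∫⁻ x, ‖g (x + y) - g x‖ₑ ^ 2 ≤ ENNReal.ofReal (N * d * h ^ 2) * gradSq g := by
  refine (hg.lintegral_translate_sub_sq_le y).trans ?_
  have hm : ∀ j k, Measurable fun x => ‖partialDeriv g j k x‖ₑ ^ 2 := fun j k =>
    (hg.continuous_partialDeriv j k).enorm.measurable.pow_const 2
  have : gradSq g = ∫⁻ x, ∑ j, ∑ k, ‖partialDeriv g j k x‖ₑ ^ 2 := by
    rw [gradSq, lintegral_finsetSum _ fun j _ => Finset.measurable_sum _ fun k _ => hm j k]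
    refine Finset.sum_congr rfl fun j _ => ?_
    rw [lintegral_finsetSum _ fun k _ => hm j k]
  rw [this, ← lintegral_const_mul' _ _ ENNReal.ofReal_ne_top]
  refine lintegral_mono fun x => ?_
  have h1 := ENNReal.ofReal_le_ofReal (norm_fderiv_apply_sq_le (g := g) x y (abs_le_of_mem_box hy))
  have h2 : ∑ j, ∑ k, ‖partialDeriv g j k x‖ₑ ^ 2
      = ENNReal.ofReal (∑ j, ∑ k, ‖partialDeriv g j k x‖ ^ 2) := by
    rw [ENNReal.ofReal_sum_of_nonneg fun j _ => by positivity]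
    refine Finset.sum_congr rfl fun j _ => ?_
    rw [ENNReal.ofReal_sum_of_nonneg fun j _ => by positivity]
    refine Finset.sum_congr rfl fun k _ => ?_
    rw [ENNReal.ofReal_pow (norm_nonneg _), ofReal_norm]
  rw [h2, ← ENNReal.ofReal_mul (by positivity), ← ofReal_norm, ← ENNReal.ofReal_pow (norm_nonneg _)]
  exact h1

/-- The integral of `g` over the cube with corner `x`. -/
noncomputable def boxIntegral (h : ℝ) (g : Config N d → ℂ) (x : Config N d) : ℂ :=
  ∫ y in box N d h, g (x + y)

theorem volume_box_ne_top (h : ℝ) : volume (box N d h) ≠ ∞ := by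
  rw [volume_box]
  finiteness

/-- The value `g x` is the mean of `g` over the box at `x` minus the mean increment; both are kept
multiplied by the volume to avoid division. -/
theorem IsTestFunction.sq_mul_le {g : Config N d → ℂ} (hg : IsTestFunction Λ g) (h : ℝ)
    (x : Config N d) :
    volume (box N d h) ^ 2 * ‖g x‖ₑ ^ 2 ≤ 2 * ‖boxIntegral h g x‖ₑ ^ 2
      + 2 * (volume (box N d h) * ∫⁻ y in box N d h, ‖g (x + y) - g x‖ₑ ^ 2) := by
  have hc : Continuous g := hg.1.continuous
  have : IsFiniteMeasure (volume.restrict (box N d h)) :=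
    ⟨by simpa using (volume_box_ne_top h).lt_top⟩
  have hi : Integrable (fun y => g (x + y)) (volume.restrict (box N d h)) := by
    refine (Continuous.integrable_of_hasCompactSupport (by fun_prop) ?_).integrableOn
    exact hg.2.1.comp_homeomorph (Homeomorph.addLeft x)
  have h1 : (volume.real (box N d h) : ℂ) * g x
      = boxIntegral h g x - ∫ y in box N d h, (g (x + y) - g x) := by
    rw [boxIntegral, integral_sub hi (integrable_const _), integral_const, sub_sub_cancel]
    simp
  have h2 : volume (box N d h) * ‖g x‖ₑ
      ≤ ‖boxIntegral h g x‖ₑ + ∫⁻ y in box N d h, ‖g (x + y) - g x‖ₑ := by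
    have h3 : volume (box N d h) * ‖g x‖ₑ = ‖(volume.real (box N d h) : ℂ) * g x‖ₑ := by
      rw [enorm_mul, ← ofReal_norm (volume.real (box N d h) : ℂ), Complex.norm_real,
        Real.norm_of_nonneg measureReal_nonneg, ofReal_measureReal (volume_box_ne_top h)]
    rw [h3, h1]
    exact (enorm_sub_le).trans (by gcongr; exact enorm_integral_le_lintegral_enorm _)
  have h4 : (∫⁻ y in box N d h, ‖g (x + y) - g x‖ₑ) ^ 2
      ≤ volume (box N d h) * ∫⁻ y in box N d h, ‖g (x + y) - g x‖ₑ ^ 2 := by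
    refine (sq_lintegral_le _ ?_).trans (by simp)
    exact (Continuous.enorm (by fun_prop)).measurable.aemeasurable
  calc volume (box N d h) ^ 2 * ‖g x‖ₑ ^ 2 = (volume (box N d h) * ‖g x‖ₑ) ^ 2 := by ring
    _ ≤ (‖boxIntegral h g x‖ₑ + ∫⁻ y in box N d h, ‖g (x + y) - g x‖ₑ) ^ 2 := by gcongr
    _ ≤ 2 * (‖boxIntegral h g x‖ₑ ^ 2 + (∫⁻ y in box N d h, ‖g (x + y) - g x‖ₑ) ^ 2) :=
        add_sq_le_two_mul _ _
    _ ≤ _ := by rw [mul_add]; gcongr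

theorem IsTestFunction.measurable_boxIntegral {g : Config N d → ℂ} (hg : IsTestFunction Λ g)
    (h : ℝ) : Measurable (boxIntegral h g) := by
  have : StronglyMeasurable (Function.uncurry fun x y : Config N d => g (x + y)) :=
    (hg.1.continuous.comp continuous_add).stronglyMeasurable
  exact (this.integral_prod_right (ν := volume.restrict (box N d h))).measurable

/-- A Poincaré type estimate: up to a kinetic term with a factor `h²`, the `L²` norm is carried by
the box averages. -/
theorem IsTestFunction.lintegral_sq_le {g : Config N d → ℂ} (hg : IsTestFunction Λ g) (h : ℝ) :
    volume (box N d h) ^ 2 * ∫⁻ x in Λ, ‖g x‖ₑ ^ 2 ≤ 2 * (∫⁻ x in Λ, ‖boxIntegral h g x‖ₑ ^ 2)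
      + 2 * (volume (box N d h) ^ 2 * (ENNReal.ofReal (N * d * h ^ 2) * gradSq g)) := by
  have hc : Continuous g := hg.1.continuous
  have hV := volume_box_ne_top (N := N) (d := d) h
  have hswap : ∫⁻ x in Λ, ∫⁻ y in box N d h, ‖g (x + y) - g x‖ₑ ^ 2
      ≤ volume (box N d h) * (ENNReal.ofReal (N * d * h ^ 2) * gradSq g) := by
    calc ∫⁻ x in Λ, ∫⁻ y in box N d h, ‖g (x + y) - g x‖ₑ ^ 2
        ≤ ∫⁻ x, ∫⁻ y in box N d h, ‖g (x + y) - g x‖ₑ ^ 2 := setLIntegral_le_lintegral _ _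
      _ = ∫⁻ y in box N d h, ∫⁻ x, ‖g (x + y) - g x‖ₑ ^ 2 := by
          refine lintegral_lintegral_swap ?_
          have : Continuous fun q : Config N d × Config N d => g (q.1 + q.2) - g q.1 := by fun_prop
          exact (this.enorm.measurable.pow_const 2).aemeasurable
      _ ≤ ∫⁻ y in box N d h, (ENNReal.ofReal (N * d * h ^ 2) * gradSq g) :=
          setLIntegral_mono measurable_const fun y hy => hg.lintegral_translate_le hy
      _ = _ := by rw [setLIntegral_const, mul_comm]
  have hm := (hg.measurable_boxIntegral h).enorm.pow_const 2
  calc volume (box N d h) ^ 2 * ∫⁻ x in Λ, ‖g x‖ₑ ^ 2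
      = ∫⁻ x in Λ, volume (box N d h) ^ 2 * ‖g x‖ₑ ^ 2 := by
        rw [lintegral_const_mul' _ _ (by finiteness)]
    _ ≤ ∫⁻ x in Λ, (2 * ‖boxIntegral h g x‖ₑ ^ 2
      + 2 * (volume (box N d h) * ∫⁻ y in box N d h, ‖g (x + y) - g x‖ₑ ^ 2)) :=
        lintegral_mono fun x => hg.sq_mul_le h x
    _ = 2 * (∫⁻ x in Λ, ‖boxIntegral h g x‖ₑ ^ 2) + 2 * (volume (box N d h) *
          ∫⁻ x in Λ, ∫⁻ y in box N d h, ‖g (x + y) - g x‖ₑ ^ 2) := by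
        rw [lintegral_add_left (hm.const_mul 2), lintegral_const_mul' _ _ (by finiteness),
          lintegral_const_mul' _ _ (by finiteness), lintegral_const_mul' _ _ hV]
    _ ≤ _ := by
        rw [sq, mul_assoc (volume _)]
        gcongr

/-- The box may stick out of `Λ`, but `v` vanishes there. -/
theorem IsTestFunction.boxIntegral_eq_inner (hΛ : MeasurableSet Λ) (v : testSubmodule Λ) (h : ℝ)
    (x : Config N d) (hs : MeasurableSet ((fun y => -x + y) ⁻¹' box N d h))
    (hμs : (volume.restrict Λ) ((fun y => -x + y) ⁻¹' box N d h) ≠ ∞) :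
    boxIntegral h v.1 x
      = ⟪(indicatorConstLp 2 hs hμs (1 : ℂ) : L2 Λ), toL2 Λ (sobolevJet Λ v)⟫_ℂ := by
  rw [L2.inner_indicatorConstLp_one]
  have h1 : (toL2 Λ (sobolevJet Λ v) : L2 Λ) =ᵐ[volume.restrict Λ] v.1 := v.2.memLp.coeFn_toLp
  rw [integral_congr_ae (ae_restrict_of_ae h1), Measure.restrict_restrict hs,
    Set.inter_comm, ← Measure.restrict_restrict hΛ, setIntegral_eq_integral_of_forall_compl_eq_zero]
  · rw [boxIntegral, ← integral_indicator (measurableSet_box h), ← integral_indicator hs,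
      ← integral_add_left_eq_self (Set.indicator _ v.1) x]
    refine integral_congr_ae (Eventually.of_forall fun y => ?_)
    have hiff : x + y ∈ (fun y => -x + y) ⁻¹' box N d h ↔ y ∈ box N d h := by
      change -x + (x + y) ∈ box N d h ↔ _
      rw [neg_add_cancel_left]
    change _ = Set.indicator _ v.1 (x + y)
    by_cases hy : y ∈ box N d h
    · rw [Set.indicator_of_mem hy, Set.indicator_of_mem (hiff.2 hy)]
    · rw [Set.indicator_of_notMem hy, Set.indicator_of_notMem (mt hiff.1 hy)]
  · intro y hy
    exact image_eq_zero_of_notMem_tsupport fun hy' => hy (v.2.2.2 hy')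

/-- Bessel's inequality for the indicator of the box at `x`. The bound is independent of `m`, and
this is what limits the dimension of trial spaces. -/
theorem sum_boxIntegral_sq_le (hΛ : MeasurableSet Λ) {m : ℕ} {v : Fin m → testSubmodule Λ}
    (hv : Orthonormal ℂ fun i => toL2 Λ (sobolevJet Λ (v i))) (h : ℝ) (x : Config N d) :
    ∑ i, ‖boxIntegral h (v i).1 x‖ₑ ^ 2 ≤ volume (box N d h) := by
  have hs : MeasurableSet ((fun y => -x + y) ⁻¹' box N d h) :=
    measurableSet_preimage (by fun_prop) (measurableSet_box h)
  have hvol : volume ((fun y => -x + y) ⁻¹' box N d h) = volume (box N d h) :=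
    measure_preimage_add _ _ _
  have hle : (volume.restrict Λ) ((fun y => -x + y) ⁻¹' box N d h) ≤ volume (box N d h) :=
    (Measure.restrict_apply_le _ _).trans hvol.le
  have hμs : (volume.restrict Λ) ((fun y => -x + y) ⁻¹' box N d h) ≠ ∞ :=
    ne_top_of_le_ne_top (volume_box_ne_top h) hle
  have hb := hv.sum_inner_products_le (indicatorConstLp 2 hs hμs (1 : ℂ)) (s := Finset.univ)
  have hn : ‖(indicatorConstLp 2 hs hμs (1 : ℂ) : L2 Λ)‖ ^ 2 ≤ volume.real (box N d h) := by
    have h4 : ⟪(indicatorConstLp 2 hs hμs (1 : ℂ) : L2 Λ), indicatorConstLp 2 hs hμs (1 : ℂ)⟫_ℂ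
        = ((volume.restrict Λ).real ((fun y => -x + y) ⁻¹' box N d h) : ℂ) := by
      rw [L2.inner_indicatorConstLp_one_indicatorConstLp_one]
      simp
    rw [inner_self_eq_norm_sq_to_K] at h4
    have h5 : ‖(indicatorConstLp 2 hs hμs (1 : ℂ) : L2 Λ)‖ ^ 2
        = (volume.restrict Λ).real ((fun y => -x + y) ⁻¹' box N d h) :=
      Complex.ofReal_injective (by simpa using h4)
    rw [h5]
    exact ENNReal.toReal_mono (volume_box_ne_top h) hle
  calc ∑ i, ‖boxIntegral h (v i).1 x‖ₑ ^ 2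
      = ENNReal.ofReal (∑ i, ‖⟪toL2 Λ (sobolevJet Λ (v i)),
          (indicatorConstLp 2 hs hμs (1 : ℂ) : L2 Λ)⟫_ℂ‖ ^ 2) := by
        rw [ENNReal.ofReal_sum_of_nonneg fun i _ => by positivity]
        refine Finset.sum_congr rfl fun i _ => ?_
        rw [IsTestFunction.boxIntegral_eq_inner hΛ (v i) h x hs hμs, ← norm_inner_symm,
          ENNReal.ofReal_pow (norm_nonneg _), ofReal_norm]
    _ ≤ ENNReal.ofReal (volume.real (box N d h)) := ENNReal.ofReal_le_ofReal (hb.trans hn)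
    _ = _ := ofReal_measureReal (volume_box_ne_top h)

theorem lintegral_sq_eq_ofReal_norm (u : L2 Λ) :
    ∫⁻ z in Λ, ‖u z‖ₑ ^ 2 = ENNReal.ofReal (‖u‖ ^ 2) := by
  rw [← integral_norm_sq_eq, ofReal_integral_eq_lintegral_ofReal
    ((Lp.memLp u).integrable_norm_pow (p := 2) (by norm_num))
    (Eventually.of_forall fun z => by positivity)]
  refine lintegral_congr fun z => ?_
  rw [ENNReal.ofReal_pow (norm_nonneg _), ofReal_norm]

theorem gradSq_eq (v : testSubmodule Λ) :
    gradSq v.1 = ENNReal.ofReal (‖gradL2 Λ (sobolevJet Λ v)‖ ^ 2) := by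
  rw [PiLp.norm_sq_eq_of_L2, ENNReal.ofReal_sum_of_nonneg fun i _ => by positivity,
    Fintype.sum_prod_type, gradSq]
  refine Finset.sum_congr rfl fun j _ => Finset.sum_congr rfl fun k _ => ?_
  rw [← lintegral_sq_eq_ofReal_norm]
  have h1 : (gradL2 Λ (sobolevJet Λ v) (j, k) : L2 Λ) =ᵐ[volume.restrict Λ] partialDeriv v.1 j k :=
    (v.2.memLp_partialDeriv j k).coeFn_toLp
  rw [lintegral_congr_ae (h1.mono fun z hz => by simp only [hz] : _ =ᵐ[volume.restrict Λ]
    fun z => ‖partialDeriv v.1 j k z‖ₑ ^ 2)]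
  refine (setLIntegral_eq_of_support_subset fun z hz => v.2.2.2 ?_).symm
  by_contra hzt
  have h0 : fderiv ℝ v.1 z = 0 := image_eq_zero_of_notMem_tsupport fun h =>
    hzt (tsupport_fderiv_subset ℝ h)
  exact hz (by simp [partialDeriv, h0])

theorem lintegral_sq_eq (v : testSubmodule Λ) :
    ∫⁻ x in Λ, ‖v.1 x‖ₑ ^ 2 = ENNReal.ofReal (‖toL2 Λ (sobolevJet Λ v)‖ ^ 2) := by
  rw [← lintegral_sq_eq_ofReal_norm]
  have h1 : (toL2 Λ (sobolevJet Λ v) : L2 Λ) =ᵐ[volume.restrict Λ] v.1 := v.2.memLp.coeFn_toLp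
  exact lintegral_congr_ae (h1.mono fun z hz => by simp only [hz])

/-- A Weyl type bound: trial spaces of bounded kinetic energy have bounded dimension. -/
theorem finrank_mul_le (hΛ : MeasurableSet Λ) (hvol : volume Λ ≠ ∞) {B h : ℝ}
    (hh : 0 < h) (hBh : 8 * (N * d * h ^ 2) * B ≤ 1) {F : Submodule ℂ (Sobolev Λ)}
    (hF : F ≤ testSpace Λ) [FiniteDimensional ℂ F]
    (hgrad : ∀ x ∈ F, 1 / 2 * ‖gradL2 Λ x‖ ^ 2 ≤ B * ‖toL2 Λ x‖ ^ 2) :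
    Module.finrank ℂ F * h ^ (N * d) ≤ 4 * volume.real Λ := by
  let f : F →ₗ[ℂ] L2 Λ := (toL2 Λ).toLinearMap ∘ₗ F.subtype
  have hf : Function.Injective f := by
    rw [injective_iff_map_eq_zero]
    intro x hx
    have hx0 : toL2 Λ (x : Sobolev Λ) = 0 := hx
    have h1 := hgrad x x.2
    have h2 := norm_sq_eq_toL2_add_gradL2 (x : Sobolev Λ)
    rw [hx0, norm_zero] at h1 h2
    have h3 : ‖(x : Sobolev Λ)‖ ^ 2 ≤ 0 := by nlinarith [sq_nonneg ‖gradL2 Λ (x : Sobolev Λ)‖]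
    exact Subtype.ext (by simpa using le_antisymm h3 (sq_nonneg _))
  rw [← LinearMap.finrank_range_of_inj hf]
  set m := Module.finrank ℂ (LinearMap.range f)
  let b := stdOrthonormalBasis ℂ (LinearMap.range f)
  have hpre : ∀ i, ∃ v : testSubmodule Λ, sobolevJet Λ v ∈ F ∧ toL2 Λ (sobolevJet Λ v) = b i := by
    intro i
    obtain ⟨x, hx⟩ := (b i).2
    obtain ⟨v, hv⟩ := mem_testSpace.1 (hF x.2)
    exact ⟨v, hv ▸ x.2, hv ▸ hx⟩
  choose v hvF hvb using hpre
  have hortho : Orthonormal ℂ fun i => toL2 Λ (sobolevJet Λ (v i)) := by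
    simp only [hvb]
    exact b.orthonormal.comp_linearIsometry (LinearMap.range f).subtypeₗᵢ
  set I : Fin m → ℝ≥0∞ := fun i => ∫⁻ x in Λ, ‖boxIntegral h (v i).1 x‖ₑ ^ 2 with hI
  have hsum : ∑ i, I i ≤ volume (box N d h) * volume Λ := by
    rw [hI, ← lintegral_finsetSum _ fun i _ =>
      ((v i).2.measurable_boxIntegral h).enorm.pow_const 2]
    refine (lintegral_mono fun x => sum_boxIntegral_sq_le hΛ hortho h x).trans ?_
    simp
  have hfin : ∀ i, I i ≠ ∞ := fun i => ne_top_of_le_ne_top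
    (ENNReal.mul_ne_top (volume_box_ne_top h) hvol)
    ((Finset.single_le_sum (fun _ _ => zero_le) (Finset.mem_univ i)).trans hsum)
  set V : ℝ := h ^ (N * d) with hV
  have hVpos : 0 < V := by positivity
  have hVbox : volume (box N d h) = ENNReal.ofReal V := by
    rw [volume_box, hV, ENNReal.ofReal_pow hh.le]
  -- By `hBh` the kinetic term of a normalized trial function is at most `V² / 2`, so its box
  -- averages retain a fixed share of the norm. Summed over `i`, this is compared with the Bessel
  -- bound `V |Λ|`.
  have hone : ∀ i, V ^ 2 / 2 ≤ 2 * (I i).toReal := by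
    intro i
    have h1 := (v i).2.lintegral_sq_le h
    have hnorm : ‖toL2 Λ (sobolevJet Λ (v i))‖ = 1 := hortho.1 i
    have hg := hgrad _ (hvF i)
    rw [hnorm] at hg
    rw [lintegral_sq_eq, gradSq_eq, hnorm, hVbox] at h1
    have h2 := ENNReal.toReal_mono (by have := hfin i; finiteness) h1
    rw [ENNReal.toReal_add (by have := hfin i; finiteness) (by finiteness)] at h2
    simp only [ENNReal.toReal_mul, ENNReal.toReal_pow, ENNReal.toReal_ofReal hVpos.le,
      ENNReal.toReal_ofNat, one_pow, ENNReal.ofReal_one, mul_one,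
      ENNReal.toReal_ofReal (sq_nonneg ‖gradL2 Λ (sobolevJet Λ (v i))‖),
      ENNReal.toReal_ofReal (show 0 ≤ N * d * h ^ 2 by positivity)] at h2
    have h3 : V ^ 2 * (N * d * h ^ 2 * ‖gradL2 Λ (sobolevJet Λ (v i))‖ ^ 2) ≤ V ^ 2 * (1 / 4) := by
      gcongr
      have : N * d * h ^ 2 * ‖gradL2 Λ (sobolevJet Λ (v i))‖ ^ 2 ≤ N * d * h ^ 2 * (2 * B) := by
        gcongr
        linarith
      linarith
    have h4 : (I i).toReal = (∫⁻ x in Λ, ‖boxIntegral h (v i).1 x‖ₑ ^ 2).toReal := rfl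
    rw [h4]
    linarith
  have htot : ∑ i, (I i).toReal ≤ V * volume.real Λ := by
    rw [← ENNReal.toReal_sum fun i _ => hfin i]
    have h1 := ENNReal.toReal_mono (ENNReal.mul_ne_top (volume_box_ne_top h) hvol) hsum
    rwa [hVbox, ENNReal.toReal_mul, ENNReal.toReal_ofReal hVpos.le] at h1
  have hm : m * (V ^ 2 / 2) ≤ 2 * ∑ i, (I i).toReal := by
    rw [Finset.mul_sum]
    have := Finset.sum_le_sum fun i (_ : i ∈ Finset.univ) => hone i
    simpa using this
  have : V * (m * V) ≤ V * (4 * volume.real Λ) := by nlinarith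
  exact le_of_mul_le_mul_left this hVpos

end BoxAverages

/-! ### Separation of distant cubes by a set of scatterers -/

section Geometry

variable {N d : ℕ} {φ : (Fin d → ℤ) → (Fin d → ℝ) → ℝ} {r₁ Cφ : ℝ}

/-- The scatterers acting on the `j`-th particle of a configuration in the cube `cube x L`. -/
def activeSites (φ : (Fin d → ℤ) → (Fin d → ℝ) → ℝ) (x : LatticeConfig N d) (L : ℕ) (j : Fin N) :
    Set (Fin d → ℤ) :=
  {a | ∃ q ∈ Metric.ball (fun k => (x j k : ℝ)) ((L : ℝ) + 1 / 2),
    φ a (fun k => q k - (a k : ℝ)) ≠ 0}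

theorem IsFlatTiling.abs_sub_le (h : IsFlatTiling φ r₁ Cφ) {a b : Fin d → ℤ} {q q' : Fin d → ℝ}
    (ha : φ a (fun k => q k - (a k : ℝ)) ≠ 0) (hb : φ b (fun k => q' k - (b k : ℝ)) ≠ 0)
    (k : Fin d) : |(q k - a k) - (q' k - b k)| ≤ r₁ :=
  (dist_le_pi_dist (fun k => q k - (a k : ℝ)) (fun k => q' k - (b k : ℝ)) k).trans
    (h.diam_support a b _ _ ha hb)

variable {L : ℕ}

/-- Two points of one ball and two offsets in the common support give `2 (L + 1/2) + r₁ ≤ 4 L`. -/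
theorem IsFlatTiling.abs_sub_le_of_mem (h : IsFlatTiling φ r₁ Cφ) (hL : 1 + r₁ ≤ 2 * (L : ℝ))
    {x : LatticeConfig N d} {j : Fin N} {a b : Fin d → ℤ} (ha : a ∈ activeSites φ x L j)
    (hb : b ∈ activeSites φ x L j) (k : Fin d) : |a k - b k| ≤ 4 * (L : ℤ) := by
  obtain ⟨q, hq, ha⟩ := ha
  obtain ⟨q', hq', hb⟩ := hb
  have h1 := abs_le.1 (h.abs_sub_le ha hb k)
  have h2 := abs_lt.1 (lt_of_le_of_lt (dist_le_pi_dist q _ k) hq)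
  have h3 := abs_lt.1 (lt_of_le_of_lt (dist_le_pi_dist q' _ k) hq')
  have : |(a k : ℝ) - b k| ≤ 4 * (L : ℝ) := abs_le.2 ⟨by linarith, by linarith⟩
  exact_mod_cast this

theorem IsFlatTiling.dist_le_of_mem (h : IsFlatTiling φ r₁ Cφ) (hL : 1 + r₁ ≤ 2 * (L : ℝ))
    {x y : LatticeConfig N d} {i j : Fin N} {a : Fin d → ℤ} (ha : a ∈ activeSites φ x L j)
    (hb : a ∈ activeSites φ y L i) : dist (x j) (y i) ≤ 4 * (L : ℝ) := by
  obtain ⟨q, hq, ha⟩ := ha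
  obtain ⟨q', hq', hb⟩ := hb
  refine (dist_pi_le_iff (by positivity)).2 fun k => ?_
  have h1 := abs_le.1 (h.abs_sub_le ha hb k)
  have h2 := abs_lt.1 (lt_of_le_of_lt (dist_le_pi_dist q _ k) hq)
  have h3 := abs_lt.1 (lt_of_le_of_lt (dist_le_pi_dist q' _ k) hq')
  rw [Int.dist_eq, abs_le]
  constructor <;> linarith

theorem IsFlatTiling.activeSites_subset (h : IsFlatTiling φ r₁ Cφ) (hL : 1 + r₁ ≤ 2 * (L : ℝ))
    (x : LatticeConfig N d) (j : Fin N) :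
    ∃ s : Finset (Fin d → ℤ), activeSites φ x L j ⊆ s ∧ s.card ≤ (8 * L + 1) ^ d := by
  rcases (activeSites φ x L j).eq_empty_or_nonempty with he | ⟨b, hb⟩
  · exact ⟨∅, by simp [he], by simp⟩
  · refine ⟨Finset.Icc (fun k => b k - 4 * L) (fun k => b k + 4 * L), fun a ha => ?_, ?_⟩
    · rw [Finset.coe_Icc]
      have := fun k => abs_le.1 (h.abs_sub_le_of_mem hL ha hb k)
      exact ⟨fun k => by linarith [(this k).1], fun k => by linarith [(this k).2]⟩
    · rw [Pi.card_Icc]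
      refine (Finset.prod_le_pow_card _ _ (8 * L + 1) fun k _ => ?_).trans (by simp)
      rw [Int.card_Icc]
      omega

theorem IsFlatTiling.finite_activeSites (h : IsFlatTiling φ r₁ Cφ) (hL : 1 + r₁ ≤ 2 * (L : ℝ))
    (x : LatticeConfig N d) (j : Fin N) : (activeSites φ x L j).Finite := by
  obtain ⟨s, hs, -⟩ := h.activeSites_subset hL x j
  exact s.finite_toSet.subset hs

/-- Distant configurations are separated by a set `Q` of scatterers: it contains all those which
act on the particles `j ∈ J` of the first cube, and acts on fewer particles of the second. -/
theorem IsFlatTiling.exists_separating (h : IsFlatTiling φ r₁ Cφ) (hL : 1 + r₁ ≤ 2 * (L : ℝ))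
    {x y : LatticeConfig N d} (hxy : 4 * (L : ℝ) < symDist x y) :
    ∃ (J I : Finset (Fin N)) (Q : Finset (Fin d → ℤ)), I.card < J.card ∧
      Q.card ≤ N * (8 * L + 1) ^ d ∧ (∀ j ∈ J, activeSites φ x L j ⊆ Q) ∧
      ∀ i ∉ I, ∀ a ∈ Q, a ∉ activeSites φ y L i := by
  classical
  let t : Fin N → Finset (Fin N) := fun j =>
    Finset.univ.filter fun i => (activeSites φ x L j ∩ activeSites φ y L i).Nonempty
  -- Under Hall's condition a matching along shared scatterers would exist. It is a permutation of
  -- the particles bringing `x` within `4 L` of `y`, which `hxy` excludes.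
  have hJ : ∃ J : Finset (Fin N), (J.biUnion t).card < J.card := by
    by_contra! hcon
    obtain ⟨f, hf, hft⟩ := (Finset.all_card_le_biUnion_card_iff_exists_injective t).1 hcon
    let e : Equiv.Perm (Fin N) := Equiv.ofBijective f (Finite.injective_iff_bijective.1 hf)
    have hle : symDist x y ≤ dist (fun j => x (e.symm j)) y :=
      Finset.inf'_le (f := fun π : Equiv.Perm (Fin N) => dist (fun j => x (π j)) y)
        (Finset.mem_univ e.symm)
    refine absurd (hxy.trans_le hle) (not_lt.2 ((dist_pi_le_iff (by positivity)).2 fun i => ?_))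
    obtain ⟨a, ha⟩ := (Finset.mem_filter.1 (hft (e.symm i))).2
    have hei : f (e.symm i) = i := e.apply_symm_apply i
    rw [hei] at ha
    exact h.dist_le_of_mem hL ha.1 ha.2
  obtain ⟨J, hJ⟩ := hJ
  have hfin := fun j => h.finite_activeSites hL x j
  refine ⟨J, J.biUnion t, J.biUnion fun j => (hfin j).toFinset, hJ, ?_, fun j hj a ha => ?_,
    fun i hi a ha hay => ?_⟩
  · refine (Finset.card_biUnion_le_card_mul _ _ ((8 * L + 1) ^ d) fun j _ => ?_).trans ?_
    · obtain ⟨s, hs, hc⟩ := h.activeSites_subset hL x j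
      refine (Finset.card_le_card fun a ha => ?_).trans hc
      exact hs (by simpa using ha)
    · gcongr
      simpa using Finset.card_le_univ J
  · exact Finset.mem_biUnion.2 ⟨j, hj, by simpa using ha⟩
  · obtain ⟨j, hj, haj⟩ := Finset.mem_biUnion.1 ha
    refine hi (Finset.mem_biUnion.2 ⟨j, hj, Finset.mem_filter.2 ⟨Finset.mem_univ _, a, ?_, hay⟩⟩)
    simpa using haj

end Geometry

/-! ### The potential in a cube as a function of finitely many amplitudes -/

section FinitePotential

variable {N d : ℕ} {φ : (Fin d → ℤ) → (Fin d → ℝ) → ℝ} {r₁ Cφ : ℝ} {U : ℝ → ℝ}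
  {A : Finset (Fin d → ℤ)} {x : LatticeConfig N d} {L : ℕ}

/-- The potential energy produced by finitely many scatterers with amplitudes `w`. -/
noncomputable def finitePotential (U : ℝ → ℝ) (φ : (Fin d → ℤ) → (Fin d → ℝ) → ℝ)
    (A : Finset (Fin d → ℤ)) (w : A → ℝ) (z : Config N d) : ℝ :=
  interaction U z + ∑ j, ∑ a : A, w a * φ a (fun k => z j k - (a.1 k : ℝ))

theorem mem_ball_of_mem_cube {z : Config N d} (hz : z ∈ cube x L) (j : Fin N) :
    z j ∈ Metric.ball (fun k => (x j k : ℝ)) ((L : ℝ) + 1 / 2) :=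
  lt_of_le_of_lt (dist_le_pi_dist z _ j) hz

theorem scatterer_eq_zero {z : Config N d} (hz : z ∈ cube x L) {j : Fin N} {a : Fin d → ℤ}
    (ha : a ∉ activeSites φ x L j) : φ a (fun k => z j k - (a k : ℝ)) = 0 := by
  by_contra h
  exact ha ⟨z j, mem_ball_of_mem_cube hz j, h⟩

theorem potential_eqOn (hA : ∀ j, activeSites φ x L j ⊆ A) (v : (Fin d → ℤ) → ℝ) :
    Set.EqOn (potential U φ v) (finitePotential U φ A fun a => v a) (cube x L) := by
  intro z hz
  unfold potential finitePotential alloyPotential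
  congr 1
  refine Finset.sum_congr rfl fun j _ => ?_
  rw [tsum_eq_sum (s := A) fun a ha => by
    rw [scatterer_eq_zero hz fun h => ha (hA j h), mul_zero]]
  exact (Finset.sum_coe_sort A fun a => v a * φ a (fun k => z j k - (a k : ℝ))).symm

theorem measurableSet_cube : MeasurableSet (cube x L) := measurableSet_ball

/-- Almost everywhere in the cube, the scatterers add up to `Cφ` at each particle. -/
theorem IsFlatTiling.ae_sum_eq (h : IsFlatTiling φ r₁ Cφ) (hA : ∀ j, activeSites φ x L j ⊆ A) :
    ∀ᵐ z ∂volume.restrict (cube x L), ∀ j,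
      ∑ a : A, φ a (fun k => z j k - (a.1 k : ℝ)) = Cφ := by
  rw [ae_restrict_iff' measurableSet_cube]
  have hj : ∀ j : Fin N, ∀ᵐ z : Config N d,
      ∑' a : Fin d → ℤ, φ a (fun k => z j k - (a k : ℝ)) = Cφ := fun j =>
    (Measure.quasiMeasurePreserving_eval (fun _ : Fin N => (volume : Measure (Fin d → ℝ))) j).ae
      h.tiling
  filter_upwards [ae_all_iff.2 hj] with z hz hzc j
  rw [← hz j, tsum_eq_sum (s := A) fun a ha => scatterer_eq_zero hzc fun h => ha (hA j h)]
  exact Finset.sum_coe_sort A fun a => φ a (fun k => z j k - (a k : ℝ))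

theorem IsFlatTiling.measurable_finitePotential (h : IsFlatTiling φ r₁ Cφ)
    (hU : IsTwoBodyPotential U) (w : A → ℝ) : Measurable (finitePotential (N := N) U φ A w) := by
  have hU' := hU.measurable
  refine Measurable.add ?_ ?_
  · refine Finset.measurable_sum _ fun i _ => Finset.measurable_sum _ fun j _ => ?_
    by_cases hij : i < j
    · simp only [hij, if_true]
      exact hU'.comp (by fun_prop)
    · simp only [hij, if_false]
      exact measurable_const
  · refine Finset.measurable_sum _ fun j _ => Finset.measurable_sum _ fun a _ => ?_
    exact ((h.measurable a).comp (by fun_prop)).const_mul _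

theorem IsTwoBodyPotential.interaction_nonneg (hU : IsTwoBodyPotential U) (z : Config N d) :
    0 ≤ interaction U z := by
  obtain ⟨ζ, C, -, -, h⟩ := hU.decay
  refine Finset.sum_nonneg fun i _ => Finset.sum_nonneg fun j _ => ?_
  split_ifs
  exacts [(h _ dist_nonneg).1, le_rfl]

theorem IsTwoBodyPotential.exists_interaction_le (hU : IsTwoBodyPotential U) :
    ∃ M : ℝ, ∀ z : Config N d, interaction U z ≤ M := by
  obtain ⟨ζ, C, -, hC, h⟩ := hU.decay
  refine ⟨∑ _i : Fin N, ∑ _j : Fin N, C, fun z =>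
    Finset.sum_le_sum fun i _ => Finset.sum_le_sum fun j _ => ?_⟩
  split_ifs
  · have h1 := (h _ (dist_nonneg (x := z i) (y := z j))).2
    have h2 : Real.exp (-(dist (z i) (z j) ^ ζ)) ≤ 1 := by
      rw [Real.exp_le_one_iff, neg_nonpos]
      positivity
    nlinarith
  · exact hC.le

/-- The scatterers are nonnegative with sum `Cφ`, so each particle feels `Cφ` times a weighted mean
of the amplitudes. -/
theorem abs_finitePotential_sub_le (hφ : ∀ a q, 0 ≤ φ a q) {z : Config N d} {δ : ℝ}
    (hz : ∀ j, ∑ a : A, φ a (fun k => z j k - (a.1 k : ℝ)) = Cφ) {w w' : A → ℝ}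
    (hw : ∀ a, |w a - w' a| ≤ δ) :
    |finitePotential U φ A w z - finitePotential U φ A w' z| ≤ N * Cφ * δ := by
  have h1 : finitePotential U φ A w z - finitePotential U φ A w' z
      = ∑ j, ∑ a : A, (w a - w' a) * φ a (fun k => z j k - (a.1 k : ℝ)) := by
    simp only [finitePotential, add_sub_add_left_eq_sub, ← Finset.sum_sub_distrib, ← sub_mul]
  rw [h1]
  calc |∑ j, ∑ a : A, (w a - w' a) * φ a (fun k => z j k - (a.1 k : ℝ))|
      ≤ ∑ j, ∑ a : A, δ * φ a (fun k => z j k - (a.1 k : ℝ)) := by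
        refine (Finset.abs_sum_le_sum_abs _ _).trans (Finset.sum_le_sum fun j _ => ?_)
        refine (Finset.abs_sum_le_sum_abs _ _).trans (Finset.sum_le_sum fun a _ => ?_)
        rw [abs_mul, abs_of_nonneg (hφ _ _)]
        exact mul_le_mul_of_nonneg_right (hw a) (hφ _ _)
    _ = N * Cφ * δ := by
        simp only [← Finset.mul_sum, hz]
        simp
        ring

theorem IsFlatTiling.memLp_finitePotential (h : IsFlatTiling φ r₁ Cφ)
    (hU : IsTwoBodyPotential U) (hA : ∀ j, activeSites φ x L j ⊆ A) (w : A → ℝ) :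
    MemLp (finitePotential U φ A w) ∞ (volume.restrict (cube x L)) := by
  obtain ⟨M, hM⟩ := hU.exists_interaction_le (N := N) (d := d)
  refine memLp_top_of_bound (h.measurable_finitePotential hU w).aestronglyMeasurable
    (M + N * Cφ * ‖w‖) ?_
  filter_upwards [h.ae_sum_eq hA] with z hz
  have h1 := abs_finitePotential_sub_le (U := U) h.nonneg hz (w := w) (w' := 0) (δ := ‖w‖)
    fun a => by simpa using norm_le_pi_norm w a
  have h2 : finitePotential U φ A 0 z = interaction U z := by simp [finitePotential]
  have h3 := hU.interaction_nonneg z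
  rw [h2] at h1
  have h4 := abs_le.1 h1
  rw [Real.norm_eq_abs, abs_le]
  constructor <;> linarith [hM z]

theorem finitePotential_nonneg (hφ : ∀ a q, 0 ≤ φ a q) (hU : IsTwoBodyPotential U) {w : A → ℝ}
    (hw : ∀ a, 0 ≤ w a) (z : Config N d) : 0 ≤ finitePotential U φ A w z :=
  add_nonneg (hU.interaction_nonneg z) (Finset.sum_nonneg fun _ _ => Finset.sum_nonneg fun a _ =>
    mul_nonneg (hw a) (hφ _ _))

theorem finitePotential_shiftOn (Q : Finset A) (t : ℝ) (w : A → ℝ) (z : Config N d) :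
    finitePotential U φ A (shiftOn Q t w) z = finitePotential U φ A w z
      + t * ∑ j, ∑ a ∈ Q, φ a (fun k => z j k - (a.1 k : ℝ)) := by
  classical
  simp only [finitePotential, shiftOn, add_mul, Finset.sum_add_distrib, add_assoc]
  congr 2
  rw [Finset.mul_sum]
  refine Finset.sum_congr rfl fun j _ => ?_
  rw [Finset.mul_sum, ← Finset.sum_subset (Finset.subset_univ Q)]
  · exact Finset.sum_congr rfl fun a ha => by simp [ha]
  · intro a _ ha
    simp [ha]

/-- A particle in `J` sees scatterers of `Q` only, so these already sum to `Cφ` there; the other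
particles can only gain energy. -/
theorem finitePotential_add_le_shiftOn (hφ : ∀ a q, 0 ≤ φ a q) {z : Config N d}
    (hzc : z ∈ cube x L) (hz : ∀ j, ∑ a : A, φ a (fun k => z j k - (a.1 k : ℝ)) = Cφ)
    {J : Finset (Fin N)} {Q : Finset A} (hJ : ∀ j ∈ J, ∀ a ∉ Q, a.1 ∉ activeSites φ x L j)
    {t : ℝ} (ht : 0 ≤ t) (w : A → ℝ) :
    finitePotential U φ A w z + J.card * Cφ * t ≤ finitePotential U φ A (shiftOn Q t w) z := by
  rw [finitePotential_shiftOn]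
  have h1 : ∀ j ∈ J, ∑ a ∈ Q, φ a (fun k => z j k - (a.1 k : ℝ)) = Cφ := by
    intro j hj
    rw [← hz j]
    exact Finset.sum_subset (Finset.subset_univ Q) fun a _ ha =>
      scatterer_eq_zero hzc (hJ j hj a ha)
  have h2 : J.card * Cφ ≤ ∑ j, ∑ a ∈ Q, φ a (fun k => z j k - (a.1 k : ℝ)) := by
    calc J.card * Cφ = ∑ j ∈ J, ∑ a ∈ Q, φ a (fun k => z j k - (a.1 k : ℝ)) := by
          rw [Finset.sum_congr rfl h1]
          simp
      _ ≤ _ := Finset.sum_le_sum_of_subset_of_nonneg (Finset.subset_univ J) fun j _ _ =>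
          Finset.sum_nonneg fun a _ => hφ _ _
  nlinarith

/-- Particles outside `I` see no scatterer of `Q`, and the others see at most the full sum `Cφ`. -/
theorem finitePotential_shiftOn_le (hφ : ∀ a q, 0 ≤ φ a q) {z : Config N d}
    (hzc : z ∈ cube x L) (hz : ∀ j, ∑ a : A, φ a (fun k => z j k - (a.1 k : ℝ)) = Cφ)
    {I : Finset (Fin N)} {Q : Finset A} (hI : ∀ i ∉ I, ∀ a ∈ Q, a.1 ∉ activeSites φ x L i)
    {t : ℝ} (ht : 0 ≤ t) (w : A → ℝ) :
    finitePotential U φ A (shiftOn Q t w) z ≤ finitePotential U φ A w z + I.card * Cφ * t := by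
  rw [finitePotential_shiftOn]
  have h2 : ∑ j, ∑ a ∈ Q, φ a (fun k => z j k - (a.1 k : ℝ)) ≤ I.card * Cφ := by
    calc ∑ j, ∑ a ∈ Q, φ a (fun k => z j k - (a.1 k : ℝ))
        = ∑ j ∈ I, ∑ a ∈ Q, φ a (fun k => z j k - (a.1 k : ℝ)) :=
          (Finset.sum_subset (Finset.subset_univ I) fun i _ hi =>
            Finset.sum_eq_zero fun a ha => scatterer_eq_zero hzc (hI i hi a ha)).symm
      _ ≤ ∑ _j ∈ I, Cφ := Finset.sum_le_sum fun j _ => by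
          rw [← hz j]
          exact Finset.sum_le_sum_of_subset_of_nonneg (Finset.subset_univ Q) fun a _ _ => hφ _ _
      _ = _ := by simp
  nlinarith

end FinitePotential

/-! ### Polynomial bound on the number of levels -/

section Counting

variable {N d : ℕ}

theorem volume_cube (x : LatticeConfig N d) (L : ℕ) :
    volume (cube x L) = ENNReal.ofReal ((2 * L + 1) ^ (N * d)) := by
  have hr : (0 : ℝ) < (L : ℝ) + 1 / 2 := by positivity
  rw [cube, volume_pi_ball _ hr]
  simp only [Real.volume_pi_ball _ hr, Finset.prod_const, Finset.card_univ, Fintype.card_fin]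
  rw [← ENNReal.ofReal_pow (by positivity), ← pow_mul, mul_comm d N]
  congr 2
  ring

theorem lt_energyLevel {Λ : Set (Config N d)} (hΛ : MeasurableSet Λ) (hvol : volume Λ ≠ ∞)
    {W : Config N d → ℝ} (hW : ∀ᵐ z ∂volume.restrict Λ, 0 ≤ W z) {B h : ℝ} (hh : 0 < h)
    (hBh : 8 * (N * d * h ^ 2) * B ≤ 1) {n : ℕ} (hn : 4 * volume.real Λ < (n + 1) * h ^ (N * d)) :
    B ≤ energyLevel Λ W B n := by
  refine le_csInf ⟨B, Set.mem_insert _ _⟩ ?_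
  rintro μ (rfl | ⟨-, F, hF, hr, hμ⟩)
  · exact le_rfl
  by_contra! hlt
  have : FiniteDimensional ℂ F := Module.finite_of_finrank_pos (by omega)
  have h1 := finrank_mul_le hΛ hvol hh hBh hF fun x hx => by
    have h2 := grad_le_energy hW x
    have h3 := hμ x hx
    nlinarith [sq_nonneg ‖toL2 Λ x‖]
  rw [hr] at h1
  push_cast at h1
  linarith

/-- The number of energy levels below `B` in a cube grows at most polynomially. -/
theorem exists_card_energyLevel_le (N d : ℕ) {B : ℝ} (hB : 0 < B) :
    ∃ c₀ > 0, ∀ (x : LatticeConfig N d) (L : ℕ), 1 ≤ L → ∃ n : ℕ, (n : ℝ) ≤ c₀ * L ^ (N * d) ∧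
      ∀ W : Config N d → ℝ, (∀ᵐ z ∂volume.restrict (cube x L), 0 ≤ W z) →
        B ≤ energyLevel (cube x L) W B n := by
  -- Chosen so that `8 N d h² B ≤ 1`; the `+ 1` keeps the root positive even if `N d = 0`.
  set h : ℝ := (Real.sqrt (8 * (N * d) * B + 1))⁻¹ with hh
  have hpos : 0 < 8 * (N * d : ℝ) * B + 1 := by positivity
  have hh0 : 0 < h := by positivity
  have hBh : 8 * (N * d * h ^ 2) * B ≤ 1 := by
    rw [hh, inv_pow, Real.sq_sqrt hpos.le]
    have : 8 * (N * d * (8 * (N * d : ℝ) * B + 1)⁻¹) * B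
        = (8 * (N * d : ℝ) * B) / (8 * (N * d : ℝ) * B + 1) := by ring
    rw [this, div_le_one hpos]
    linarith
  refine ⟨4 * 3 ^ (N * d) / h ^ (N * d), by positivity, fun x L hL =>
    ⟨⌊4 * (2 * (L : ℝ) + 1) ^ (N * d) / h ^ (N * d)⌋₊, ?_, fun W hW => ?_⟩⟩
  · refine (Nat.floor_le (by positivity)).trans ?_
    have hL' : (1 : ℝ) ≤ L := by exact_mod_cast hL
    have h1 : (2 * (L : ℝ) + 1) ^ (N * d) ≤ (3 * (L : ℝ)) ^ (N * d) := by
      gcongr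
      linarith
    rw [mul_pow] at h1
    rw [div_mul_eq_mul_div, mul_assoc]
    gcongr
  -- Level `n` refers to trial spaces of dimension `n + 1`, so the floor itself suffices.
  · refine lt_energyLevel measurableSet_cube (by rw [volume_cube]; finiteness) hW hh0 hBh ?_
    rw [measureReal_def, volume_cube, ENNReal.toReal_ofReal (by positivity),
      ← div_lt_iff₀ (by positivity)]
    exact Nat.lt_floor_add_one _

end Counting

/-! ### Levels of two cubes as functions of the amplitudes -/

section Spacing

variable {N d : ℕ} {φ : (Fin d → ℤ) → (Fin d → ℝ) → ℝ} {r₁ Cφ : ℝ} {U : ℝ → ℝ}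
  {A : Finset (Fin d → ℤ)} {x y : LatticeConfig N d} {L : ℕ} {B : ℝ}

theorem IsFlatTiling.energyLevel_le_add (h : IsFlatTiling φ r₁ Cφ) (hC : 0 ≤ Cφ)
    (hU : IsTwoBodyPotential U) (hA : ∀ j, activeSites φ x L j ⊆ A) (hB : 0 ≤ B) (k : ℕ)
    (w w' : A → ℝ) :
    energyLevel (cube x L) (finitePotential U φ A w) B k
      ≤ energyLevel (cube x L) (finitePotential U φ A w') B k + N * Cφ * dist w w' := by
  refine level_le_level_add hB (by positivity) fun u => ?_
  refine energy_le_energy_add (h.memLp_finitePotential hU hA w)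
    (h.memLp_finitePotential hU hA w') ?_ u
  filter_upwards [h.ae_sum_eq hA] with z hz
  have := (abs_le.1 (abs_finitePotential_sub_le (U := U) h.nonneg hz (w := w) (w' := w')
    (δ := dist w w') fun a => dist_le_pi_dist w w' a)).2
  linarith

/-- Continuity in the amplitudes serves to make `closeLevels` a closed, hence measurable, set. -/
theorem IsFlatTiling.continuous_energyLevel (h : IsFlatTiling φ r₁ Cφ) (hC : 0 ≤ Cφ)
    (hU : IsTwoBodyPotential U) (hA : ∀ j, activeSites φ x L j ⊆ A) (hB : 0 ≤ B) (k : ℕ) :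
    Continuous fun w : A → ℝ => energyLevel (cube x L) (finitePotential U φ A w) B k := by
  refine (LipschitzWith.of_le_add_mul (Real.toNNReal (N * Cφ)) fun w w' => ?_).continuous
  rw [Real.coe_toNNReal _ (by positivity)]
  exact h.energyLevel_le_add hC hU hA hB k w w'

/-- The amplitudes for which the levels of index `k` and `l` of two cubes are close. -/
def closeLevels (U : ℝ → ℝ) (φ : (Fin d → ℤ) → (Fin d → ℝ) → ℝ) (A : Finset (Fin d → ℤ))
    (x y : LatticeConfig N d) (L : ℕ) (Emax s : ℝ) (k l : ℕ) : Set (A → ℝ) :=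
  {w | (∀ a, 0 ≤ w a) ∧
    energyLevel (cube x L) (finitePotential U φ A w) (Emax + 1) k ≤ Emax ∧
    |energyLevel (cube x L) (finitePotential U φ A w) (Emax + 1) k
      - energyLevel (cube y L) (finitePotential U φ A w) (Emax + 1) l| ≤ s}

variable {Emax s : ℝ} {k l : ℕ}

theorem IsFlatTiling.measurableSet_closeLevels (h : IsFlatTiling φ r₁ Cφ) (hC : 0 ≤ Cφ)
    (hU : IsTwoBodyPotential U) (hx : ∀ j, activeSites φ x L j ⊆ A)
    (hy : ∀ j, activeSites φ y L j ⊆ A) (hE : 0 ≤ Emax) :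
    MeasurableSet (closeLevels U φ A x y L Emax s k l) := by
  have h1 := h.continuous_energyLevel hC hU hx (B := Emax + 1) (by positivity) k
  have h2 := h.continuous_energyLevel hC hU hy (B := Emax + 1) (by positivity) l
  refine IsClosed.measurableSet (IsClosed.inter ?_ (IsClosed.inter ?_ ?_))
  · exact isClosed_Ici (a := (0 : A → ℝ))
  · exact isClosed_le h1 continuous_const
  · exact isClosed_le (h1.sub h2).abs continuous_const

/-- Raising the amplitudes of a separating set of scatterers drives the levels apart. -/
theorem IsFlatTiling.shiftOn_notMem_closeLevels (h : IsFlatTiling φ r₁ Cφ) (hC : 0 < Cφ)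
    (hU : IsTwoBodyPotential U) (hx : ∀ j, activeSites φ x L j ⊆ A)
    (hy : ∀ j, activeSites φ y L j ⊆ A) (hE : 0 ≤ Emax) (hs : 0 ≤ s)
    {I J : Finset (Fin N)} {Q : Finset A} (hIJ : I.card < J.card)
    (hJ : ∀ j ∈ J, ∀ a ∉ Q, a.1 ∉ activeSites φ x L j)
    (hI : ∀ i ∉ I, ∀ a ∈ Q, a.1 ∉ activeSites φ y L i) {w : A → ℝ}
    (hw : w ∈ closeLevels U φ A x y L Emax s k l) {t : ℝ} (ht : 2 * s / Cφ < t) :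
    shiftOn Q t w ∉ closeLevels U φ A x y L Emax s k l := by
  intro hw'
  have ht0 : 0 ≤ t := (by positivity : 0 ≤ 2 * s / Cφ).trans ht.le
  have hB : 0 ≤ Emax + 1 := by positivity
  -- The cap `Emax` in `closeLevels` keeps the raised level below the truncation at `Emax + 1`. The
  -- upper bound `h2` on the second level holds regardless of truncation.
  have h1 : energyLevel (cube x L) (finitePotential U φ A w) (Emax + 1) k + J.card * Cφ * t
      ≤ energyLevel (cube x L) (finitePotential U φ A (shiftOn Q t w)) (Emax + 1) k := by
    refine level_add_le hB (fun u => ?_) (fun u => ?_) (fun u hu hu0 => ?_)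
      (hw'.2.1.trans_lt (by linarith))
    · refine energy_add_le_energy (h.memLp_finitePotential hU hx _)
        (h.memLp_finitePotential hU hx _) ?_ u
      filter_upwards [h.ae_sum_eq hx, ae_restrict_mem measurableSet_cube] with z hz hzc
      exact finitePotential_add_le_shiftOn h.nonneg hzc hz hJ ht0 w
    · exact le_trans (by positivity) (grad_le_energy
        (Eventually.of_forall fun z => finitePotential_nonneg h.nonneg hU hw.1 z) u)
    · exact eq_zero_of_energy_nonpos
        (Eventually.of_forall fun z => finitePotential_nonneg h.nonneg hU hw'.1 z) u hu hu0
  have h2 : energyLevel (cube y L) (finitePotential U φ A (shiftOn Q t w)) (Emax + 1) l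
      ≤ energyLevel (cube y L) (finitePotential U φ A w) (Emax + 1) l + I.card * Cφ * t := by
    refine level_le_level_add hB (by positivity) fun u => ?_
    refine energy_le_energy_add (h.memLp_finitePotential hU hy _)
      (h.memLp_finitePotential hU hy _) ?_ u
    filter_upwards [h.ae_sum_eq hy, ae_restrict_mem measurableSet_cube] with z hz hzc
    exact finitePotential_shiftOn_le h.nonneg hzc hz hI ht0 w
  -- The difference of the levels grows by at least `Cφ t > 2 s`, too much to remain in `[-s, s]`.
  have h3 : (I.card : ℝ) + 1 ≤ J.card := by exact_mod_cast hIJ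
  have h4 : (I.card : ℝ) * Cφ * t + Cφ * t ≤ J.card * Cφ * t := by
    have := mul_le_mul_of_nonneg_right h3 (mul_nonneg hC.le ht0)
    linarith
  have h5 : 2 * s < Cφ * t := by
    rwa [div_lt_iff₀ hC, mul_comm t] at ht
  have h6 := (abs_le.1 hw.2.2).1
  have h7 := (abs_le.1 hw'.2.2).2
  linarith

theorem IsFlatTiling.mem_closeLevels_of_setDist_le (h : IsFlatTiling φ r₁ Cφ)
    (hU : IsTwoBodyPotential U) (hx : ∀ j, activeSites φ x L j ⊆ A)
    (hy : ∀ j, activeSites φ y L j ⊆ A) (hs : 0 < s) {v : (Fin d → ℤ) → ℝ} (hv : ∀ a, 0 ≤ v a)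
    {n m : ℕ}
    (hn : ∀ W : Config N d → ℝ, (∀ᵐ z ∂volume.restrict (cube x L), 0 ≤ W z) →
        Emax + 1 ≤ energyLevel (cube x L) W (Emax + 1) n)
    (hm : ∀ W : Config N d → ℝ, (∀ᵐ z ∂volume.restrict (cube y L), 0 ≤ W z) →
        Emax + 1 ≤ energyLevel (cube y L) W (Emax + 1) m)
    (hdist : setDist (spectrumUpTo (cube x L) (potential U φ v) Emax)
      (spectrumUpTo (cube y L) (potential U φ v) Emax) ≤ ENNReal.ofReal s) :
    ∃ k < n, ∃ l < m, (fun a : A => v a) ∈ closeLevels U φ A x y L Emax (2 * s) k l := by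
  -- The infimum need not be attained; the slack from `s` to `2 s` provides actual points of the two
  -- spectra.
  have hlt : setDist (spectrumUpTo (cube x L) (potential U φ v) Emax)
      (spectrumUpTo (cube y L) (potential U φ v) Emax) < ENNReal.ofReal (2 * s) :=
    hdist.trans_lt ((ENNReal.ofReal_lt_ofReal_iff (by positivity)).2 (by linarith))
  obtain ⟨a, ha⟩ := iInf_lt_iff.1 hlt
  obtain ⟨hax, ha⟩ := iInf_lt_iff.1 ha
  obtain ⟨b, hby, hab⟩ := Metric.infEDist_lt_iff.1 ha
  have hab' : |a - b| ≤ 2 * s := by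
    rw [edist_dist, ENNReal.ofReal_lt_ofReal_iff (by positivity)] at hab
    exact hab.le
  have hnonneg : ∀ z : Config N d, 0 ≤ finitePotential U φ A (fun a => v a) z :=
    finitePotential_nonneg h.nonneg hU fun a => hv a
  have key : ∀ (u : LatticeConfig N d) (hu : ∀ j, activeSites φ u L j ⊆ A) (n : ℕ),
      (∀ W : Config N d → ℝ, (∀ᵐ z ∂volume.restrict (cube u L), 0 ≤ W z) →
        Emax + 1 ≤ energyLevel (cube u L) W (Emax + 1) n) →
      ∀ E ∈ spectrumUpTo (cube u L) (potential U φ v) Emax, ∃ k < n,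
        energyLevel (cube u L) (finitePotential U φ A fun a => v a) (Emax + 1) k = E := by
    intro u hu n hn E hE
    have heq := potential_eqOn (U := U) hu v
    have hLp : MemLp (potential U φ v) ∞ (volume.restrict (cube u L)) :=
      (memLp_congr_ae ((ae_restrict_iff' measurableSet_cube).2
        (Eventually.of_forall fun z hz => heq hz))).2 (h.memLp_finitePotential hU hu _)
    have hlev : energyLevel (cube u L) (potential U φ v) (Emax + 1)
        = energyLevel (cube u L) (finitePotential U φ A fun a => v a) (Emax + 1) := by
      funext k
      rw [energyLevel, energyLevel, energy_congr measurableSet_cube heq]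
    have hbig := hn _ (Eventually.of_forall hnonneg)
    have := exists_energyLevel_eq hLp hE (lt_add_one Emax) (n := n)
      (by rw [hlev]; linarith)
    rwa [hlev] at this
  obtain ⟨k, hk, hka⟩ := key x hx n hn a hax
  obtain ⟨l, hl, hlb⟩ := key y hy m hm b hby
  exact ⟨k, hk, l, hl, fun a => hv a, by rw [hka]; exact hax.2.2, by rw [hka, hlb]; exact hab'⟩

theorem IsIIDField.map_restrict_eq {Ω : Type*} [MeasurableSpace Ω] {P : Measure Ω}
    {𝒱 : (Fin d → ℤ) → Ω → ℝ} {p : ℝ → ℝ} (h : IsIIDField P 𝒱 p) [IsProbabilityMeasure P]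
    (A : Finset (Fin d → ℤ)) :
    P.map (fun ω (a : A) => 𝒱 a ω) = Measure.pi fun _ : A => amplitudeLaw p := by
  have h1 : iIndepFun (fun a : A => 𝒱 a) P := h.indep.precomp Subtype.val_injective
  rw [(iIndepFun_iff_map_fun_eq_pi_map fun a : A => (h.measurable a).aemeasurable).1 h1]
  congr 1
  funext a
  exact h.law a

theorem IsIIDField.isProbabilityMeasure {Ω : Type*} [MeasurableSpace Ω] {P : Measure Ω}
    {𝒱 : (Fin d → ℤ) → Ω → ℝ} {p : ℝ → ℝ} (h : IsIIDField P 𝒱 p) [IsProbabilityMeasure P] :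
    IsProbabilityMeasure (amplitudeLaw p) := by
  rw [amplitudeLaw, ← h.law 0]
  exact Measure.isProbabilityMeasure_map (h.measurable 0).aemeasurable

theorem IsIIDField.ae_nonneg {Ω : Type*} [MeasurableSpace Ω] {P : Measure Ω}
    {𝒱 : (Fin d → ℤ) → Ω → ℝ} {p : ℝ → ℝ} {c : ℝ} (h : IsIIDField P 𝒱 p)
    (hp : IsAmplitudeDensity p c) : ∀ᵐ ω ∂P, ∀ a, 0 ≤ 𝒱 a ω := by
  refine ae_all_iff.2 fun a => ?_
  have h1 : P.map (𝒱 a) (Set.Iio 0) = 0 := by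
    rw [h.law a]
    exact hp.law_Iio_zero
  rw [Measure.map_apply (h.measurable a) measurableSet_Iio] at h1
  rw [ae_iff]
  refine measure_mono_null (fun ω hω => ?_) h1
  exact not_le.1 hω

end Spacing

end MultiParticle

/-! ### Union bound over pairs of levels -/

open MultiParticle
theorem theorem2p2 (N d : ℕ) (hN : 1 ≤ N) (hd : 1 ≤ d) (Emax : ℝ) (hE : 0 < Emax)
    (p : ℝ → ℝ) (c : ℝ) (hp : IsAmplitudeDensity p c) (Cφ : ℝ) (hCφ : 0 < Cφ) :
    ∃ C₂ A₂ : ℝ, 0 < C₂ ∧ 0 < A₂ ∧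
      ∀ (Ω : Type*) [MeasurableSpace Ω] (P : Measure Ω) [IsProbabilityMeasure P]
        (𝒱 : (Fin d → ℤ) → Ω → ℝ), IsIIDField P 𝒱 p →
      ∀ (φ : (Fin d → ℤ) → (Fin d → ℝ) → ℝ) (r₁ : ℝ), IsFlatTiling φ r₁ Cφ →
      ∀ U : ℝ → ℝ, IsTwoBodyPotential U →
      ∀ L : ℕ, 1 ≤ L → 1 + r₁ ≤ 2 * (L : ℝ) →
      ∀ x y : LatticeConfig N d, 4 * (N : ℝ) * (L : ℝ) < symDist x y →
      ∀ s : ℝ, 0 < s → s ≤ 1 →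
        P {ω | setDist
              (spectrumUpTo (cube x L) (potential U φ (fun a => 𝒱 a ω)) Emax)
              (spectrumUpTo (cube y L) (potential U φ (fun a => 𝒱 a ω)) Emax)
            ≤ ENNReal.ofReal s}
          ≤ ENNReal.ofReal (C₂ * (L : ℝ) ^ A₂ * s ^ (2 / 3 : ℝ)) := by
  classical
  obtain ⟨C, hC, hprob⟩ := hp.exists_measure_le
  obtain ⟨c₀, hc₀, hcount⟩ := exists_card_energyLevel_le N d (B := Emax + 1) (by positivity)
  -- `c₀²` and `L^(2 N d)` count pairs of levels, `(|Q'| + 1)²` contributes `(N 9^d + 1)² L^(2 d)`,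
  -- and `4 s / Cφ` is the diameter along lines for levels within `2 s`.
  refine ⟨c₀ ^ 2 * (C * (N * 9 ^ d + 1) ^ 2 * (4 / Cφ) ^ (2 / 3 : ℝ)),
    ((2 * (N * d) + 2 * d : ℕ) : ℝ), by positivity, by exact_mod_cast (by omega), ?_⟩
  intro Ω _ P _ 𝒱 h𝒱 φ r₁ hφ U hU L hL hr₁ x y hxy s hs _
  have hL' : (1 : ℝ) ≤ L := by exact_mod_cast hL
  have hxy' : 4 * (L : ℝ) < symDist x y := by
    have : (1 : ℝ) ≤ N := by exact_mod_cast hN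
    nlinarith
  obtain ⟨J, I, Q, hIJ, hQ, hJ, hI⟩ := hφ.exists_separating hr₁ hxy'
  obtain ⟨n, hn, hlevx⟩ := hcount x L hL
  obtain ⟨m, hm, hlevy⟩ := hcount y L hL
  -- All scatterers acting in either cube; both potentials depend on these finitely many amplitudes
  -- alone.
  let A : Finset (Fin d → ℤ) := Finset.univ.biUnion fun j =>
    (hφ.finite_activeSites hr₁ x j).toFinset ∪ (hφ.finite_activeSites hr₁ y j).toFinset
  have hx : ∀ j, activeSites φ x L j ⊆ A := fun j a ha =>
    Finset.mem_biUnion.2 ⟨j, Finset.mem_univ _, Finset.mem_union_left _ (by simpa using ha)⟩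
  have hy : ∀ j, activeSites φ y L j ⊆ A := fun j a ha =>
    Finset.mem_biUnion.2 ⟨j, Finset.mem_univ _, Finset.mem_union_right _ (by simpa using ha)⟩
  let Q' : Finset A := Q.subtype (· ∈ A)
  have hQ' : (Q'.card : ℝ) + 1 ≤ (N * 9 ^ d + 1) * L ^ d := by
    have h1 : Q'.card ≤ N * (8 * L + 1) ^ d := by
      refine le_trans ?_ hQ
      rw [Finset.card_subtype]
      exact Finset.card_filter_le _ _
    have h2 : (8 * L + 1) ^ d ≤ 9 ^ d * L ^ d := by
      rw [← mul_pow]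
      gcongr
      omega
    have h3 : 1 ≤ L ^ d := Nat.one_le_pow _ _ hL
    have h4 : Q'.card + 1 ≤ (N * 9 ^ d + 1) * L ^ d := by nlinarith
    exact_mod_cast h4
  set S : ℕ → ℕ → Set (A → ℝ) := fun k l => closeLevels U φ A x y L Emax (2 * s) k l with hS
  have hlaw := h𝒱.map_restrict_eq A
  have hpr := h𝒱.isProbabilityMeasure
  set b : ℝ := C * (Q'.card + 1) ^ 2 * (4 * s / Cφ) ^ (2 / 3 : ℝ) with hb
  have hSm : ∀ k l, MeasurableSet (S k l) := fun k l =>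
    hφ.measurableSet_closeLevels hCφ.le hU hx hy hE.le
  have hPS : ∀ k l, P ((fun ω (a : A) => 𝒱 a ω) ⁻¹' S k l) ≤ ENNReal.ofReal b := by
    intro k l
    have hm𝒱 : Measurable fun ω (a : A) => 𝒱 a ω := measurable_pi_lambda _ fun a => h𝒱.measurable a
    rw [← Measure.map_apply hm𝒱 (hSm k l), hlaw]
    refine hprob Q' hpr (S k l) (hSm k l) (4 * s / Cφ) (by positivity) fun v hv t ht => ?_
    refine hφ.shiftOn_notMem_closeLevels hCφ hU hx hy hE.le (by positivity) hIJ ?_ ?_ hv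
      (lt_of_le_of_lt (le_of_eq (by ring)) ht)
    · exact fun j hj a ha haj => ha (Finset.mem_subtype.2 (hJ j hj haj))
    · exact fun i hi a ha => hI i hi a (Finset.mem_subtype.1 ha)
  calc P {ω | setDist (spectrumUpTo (cube x L) (potential U φ (fun a => 𝒱 a ω)) Emax)
          (spectrumUpTo (cube y L) (potential U φ (fun a => 𝒱 a ω)) Emax) ≤ ENNReal.ofReal s}
      ≤ P (⋃ k ∈ Finset.range n, ⋃ l ∈ Finset.range m, (fun ω (a : A) => 𝒱 a ω) ⁻¹' S k l) := by
        refine measure_mono_ae ?_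
        filter_upwards [h𝒱.ae_nonneg hp] with ω hω hdist
        obtain ⟨k, hk, l, hl, hmem⟩ :=
          hφ.mem_closeLevels_of_setDist_le hU hx hy hs hω hlevx hlevy hdist
        exact Set.mem_biUnion (Finset.mem_range.2 hk) (Set.mem_biUnion (Finset.mem_range.2 hl) hmem)
    _ ≤ ∑ k ∈ Finset.range n, ∑ l ∈ Finset.range m,
          P ((fun ω (a : A) => 𝒱 a ω) ⁻¹' S k l) :=
        (measure_biUnion_finset_le _ _).trans
          (Finset.sum_le_sum fun k _ => measure_biUnion_finset_le _ _)
    _ ≤ ∑ k ∈ Finset.range n, ∑ l ∈ Finset.range m, ENNReal.ofReal b :=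
        Finset.sum_le_sum fun k _ => Finset.sum_le_sum fun l _ => hPS k l
    _ = ENNReal.ofReal (n * (m * b)) := by
        have hb0 : 0 ≤ b := by positivity
        simp only [Finset.sum_const, Finset.card_range, nsmul_eq_mul]
        rw [ENNReal.ofReal_mul (Nat.cast_nonneg _), ENNReal.ofReal_mul (Nat.cast_nonneg _),
          ENNReal.ofReal_natCast, ENNReal.ofReal_natCast]
    _ ≤ _ := by
        refine ENNReal.ofReal_le_ofReal ?_
        rw [Real.rpow_natCast]
        have hsplit : (4 * s / Cφ) ^ (2 / 3 : ℝ) = (4 / Cφ) ^ (2 / 3 : ℝ) * s ^ (2 / 3 : ℝ) := by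
          rw [← Real.mul_rpow (by positivity) hs.le]
          congr 1
          ring
        calc (n : ℝ) * (m * b)
            ≤ (c₀ * L ^ (N * d)) * ((c₀ * L ^ (N * d)) *
              (C * ((N * 9 ^ d + 1) * L ^ d) ^ 2 * (4 * s / Cφ) ^ (2 / 3 : ℝ))) := by
              rw [hb]
              gcongr
          _ = _ := by
              rw [hsplit]
              ring
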